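/- Let $M$ be a finite-dimensional $\sigma$-compact (Hausdorff) smooth manifold and let $\mathfrak K\to M$ be a Lie algebra bundle whose typical fiber $\mathfrak g$ is a finite-dimensional perfect real Lie algebra. For a real Lie algebra $\mathfrak l$ let $V(\mathfrak l)$ be the quotient of the symmetric square $S^2(\mathfrak l)$ by the span of all $[x,y]\vee z-x\vee[y,z]$, and let $\kappa_{\mathfrak l}(x,y)=[x\vee y]\in V(\mathfrak l)$. Let $V(\mathfrak K)\to M$ be the vector bundle with fibers $V(\mathfrak K_p)$, whose local trivializations are induced by those of $\mathfrak K$. Spaces $C_c^\infty(M,\mathbb V)$ of compactly supported smooth sections and $\Omega^1_c(M,\mathbb V)$ of compactly supported $\mathbb V$-valued one-forms carry their usual topologies, as locally convex inductive limits of the spaces of sections (forms) supported in a compact set $C\subseteq M$, the latter with the $C^\infty$-topology; $C_c^\infty(M,\mathfrak K)$ is a Lie algebra with the pointwise bracket. A linear map $d\colon C_c^\infty(M,\mathbb V)\to\Omega_c^1(M,\mathbb V)$ is a Koszul connection if $d(f\eta)=f\,d\eta+\eta\,df$ for all $f\in C^\infty(M,\mathbb R)$ and $\eta\in C_c^\infty(M,\mathbb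 V)$; a Koszul connection $D$ on $\mathfrak K$ is a Lie connection if $D[\eta,\tau]=[D\eta,\tau]+[\eta,D\tau]$. Put $\kappa_{\mathfrak K}(\eta,\zeta)(p)=\kappa_{\mathfrak K_p}(\eta(p),\zeta(p))$ for $\eta,\zeta\in C^\infty_c(M,\mathfrak K)$, and $\tilde\kappa_{\mathfrak K}(\alpha,\eta)_p(v)=\kappa_{\mathfrak K_p}(\alpha_p(v),\eta(p))$ for $\alpha\in\Omega^1_c(M,\mathfrak K)$. Let $D\colon C_c^\infty(M,\mathfrak K)\to\Omega^1_c(M,\mathfrak K)$ be a continuous Lie connection. Then there is a unique continuous Koszul connection $d\colon C_c^\infty(M,V(\mathfrak K))\to\Omega_c^1(M,V(\mathfrak K))$ with $$d\,\kappa_{\mathfrak K}(\zeta,\eta)=\tilde\kappa_{\mathfrak K}(D\zeta,\eta)+\tilde\kappa_{\mathfrak K}(D\eta,\zeta)\qquad\text{for all }\zeta,\eta\in C_c^\infty(M,\mathfrak K).$$ Let $\overline\Omega{}^1_c(M,V(\mathfrak K)):=\Omega_c^1(M,V(\mathfrak K))/d\,C_c^\infty(M,V(\mathfrak K))$, with the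 quotient topology. The bilinear map $$\omega\colon C_c^\infty(M,\mathfrak K)\times C_c^\infty(M,\mathfrak K)\to\overline\Omega{}^1_c(M,V(\mathfrak K)),\qquad \omega(\eta,\zeta)=[\tilde\kappa_{\mathfrak K}(D\eta,\zeta)],$$ is a Lie algebra 2-cocycle of $C_c^\infty(M,\mathfrak K)$ with values in the trivial module $\overline\Omega{}^1_c(M,V(\mathfrak K))$, i.e. $\omega$ is alternating and $\omega([\eta_1,\eta_2],\eta_3)+\omega([\eta_2,\eta_3],\eta_1)+\omega([\eta_3,\eta_1],\eta_2)=0$, and $\omega$ is (jointly) continuous. -/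

import Mathlib

open Bundle Set Topology
open scoped Manifold ContDiff TensorProduct

noncomputable section

set_option linter.unusedSectionVars false

/-! ### The universal invariant symmetric bilinear form of a Lie algebra -/

section UniversalForm

variable (L : Type*) [LieRing L] [LieAlgebra ℝ L]

/-- The relations of symmetry `x ⊗ y = y ⊗ x` and of invariance `[x, y] ⊗ z = x ⊗ [y, z]`. -/
def invariantRelations : Submodule ℝ (L ⊗[ℝ] L) :=
  Submodule.span ℝ
    ({u | ∃ x y : L, u = x ⊗ₜ[ℝ] y - y ⊗ₜ[ℝ] x} ∪
      {u | ∃ x y z : L, u = ⁅x, y⁆ ⊗ₜ[ℝ] z - x ⊗ₜ[ℝ] ⁅y, z⁆})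

/-- The space `V(L)`: the symmetric square of `L` modulo the span of the elements
`[x, y] ∨ z - x ∨ [y, z]`. -/
abbrev UniversalFormSpace : Type _ := (L ⊗[ℝ] L) ⧸ invariantRelations L

/-- The universal invariant symmetric bilinear form `κ_L : L × L → V(L)`. -/
def universalForm : L →ₗ[ℝ] L →ₗ[ℝ] UniversalFormSpace L :=
  (TensorProduct.mk ℝ L L).compr₂ (invariantRelations L).mkQ

variable {L}

lemma universalForm_apply (x y : L) :
    universalForm L x y = (invariantRelations L).mkQ (x ⊗ₜ[ℝ] y) := rfl

lemma universalForm_symm (x y : L) : universalForm L x y = universalForm L y x := by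
  rw [← sub_eq_zero, universalForm_apply, universalForm_apply, ← map_sub, Submodule.mkQ_apply,
    Submodule.Quotient.mk_eq_zero]
  exact Submodule.subset_span (Or.inl ⟨x, y, rfl⟩)

lemma universalForm_invariant (x y z : L) :
    universalForm L ⁅x, y⁆ z = universalForm L x ⁅y, z⁆ := by
  rw [← sub_eq_zero, universalForm_apply, universalForm_apply, ← map_sub, Submodule.mkQ_apply,
    Submodule.Quotient.mk_eq_zero]
  exact Submodule.subset_span (Or.inr ⟨x, y, z, rfl⟩)

variable {L' L'' : Type*} [LieRing L'] [LieAlgebra ℝ L'] [LieRing L''] [LieAlgebra ℝ L'']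

lemma invariantRelations_le_comap (f : L →ₗ⁅ℝ⁆ L') :
    invariantRelations L ≤ (invariantRelations L').comap
      (TensorProduct.map (f : L →ₗ[ℝ] L') (f : L →ₗ[ℝ] L')) := by
  rw [invariantRelations, Submodule.span_le]
  rintro u (⟨x, y, rfl⟩ | ⟨x, y, z, rfl⟩)
  · refine Submodule.subset_span (Or.inl ⟨f x, f y, ?_⟩)
    simp
  · refine Submodule.subset_span (Or.inr ⟨f x, f y, f z, ?_⟩)
    simp

/-- The linear map `f_κ : V(L) → V(L')` induced by a Lie algebra homomorphism `f : L → L'`; it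
satisfies `f_κ (κ_L (x, y)) = κ_{L'} (f x, f y)`. -/
def UniversalFormSpace.map (f : L →ₗ⁅ℝ⁆ L') : UniversalFormSpace L →ₗ[ℝ] UniversalFormSpace L' :=
  Submodule.mapQ _ _ (TensorProduct.map (f : L →ₗ[ℝ] L') (f : L →ₗ[ℝ] L'))
    (invariantRelations_le_comap f)

@[simp] lemma UniversalFormSpace.map_mkQ (f : L →ₗ⁅ℝ⁆ L') (u : L ⊗[ℝ] L) :
    UniversalFormSpace.map f ((invariantRelations L).mkQ u) =
      (invariantRelations L').mkQ
        (TensorProduct.map (f : L →ₗ[ℝ] L') (f : L →ₗ[ℝ] L') u) := rfl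

@[simp] lemma UniversalFormSpace.map_universalForm (f : L →ₗ⁅ℝ⁆ L') (x y : L) :
    UniversalFormSpace.map f (universalForm L x y) = universalForm L' (f x) (f y) := rfl

lemma UniversalFormSpace.map_map (f : L →ₗ⁅ℝ⁆ L') (g : L' →ₗ⁅ℝ⁆ L'') (u : UniversalFormSpace L) :
    UniversalFormSpace.map g (UniversalFormSpace.map f u) =
      UniversalFormSpace.map (g.comp f) u := by
  obtain ⟨u, rfl⟩ := Submodule.mkQ_surjective _ u
  simp only [map_mkQ]
  congr 1
  rw [← LinearMap.comp_apply, ← TensorProduct.map_comp]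
  rfl

lemma UniversalFormSpace.map_eq_self (f : L →ₗ⁅ℝ⁆ L) (hf : ∀ x, f x = x)
    (u : UniversalFormSpace L) : UniversalFormSpace.map f u = u := by
  obtain ⟨u, rfl⟩ := Submodule.mkQ_surjective _ u
  have : (f : L →ₗ[ℝ] L) = LinearMap.id := LinearMap.ext hf
  rw [map_mkQ, this, TensorProduct.map_id, LinearMap.id_apply]

/-- The coordinate space of `V(L)`, for a finite-dimensional `L`. -/
abbrev UniversalFormModel (L : Type*) [LieRing L] [LieAlgebra ℝ L] : Type :=
  Fin (Module.finrank ℝ (UniversalFormSpace L)) → ℝ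

/-- Coordinates on `V(L)` with respect to a basis. -/
def universalFormCoord (L : Type*) [LieRing L] [LieAlgebra ℝ L] [FiniteDimensional ℝ L] :
    UniversalFormSpace L ≃ₗ[ℝ] UniversalFormModel L :=
  (Module.finBasis ℝ (UniversalFormSpace L)).equivFun

end UniversalForm

/-! ### Lie algebra bundles -/

section LieAlgebraBundle

variable {M : Type*} [TopologicalSpace M]
  (F : Type*) [NormedAddCommGroup F] [NormedSpace ℝ F]
  (g : Type*) [LieRing g] [LieAlgebra ℝ g]
  (K : M → Type*) [∀ x, LieRing (K x)] [∀ x, LieAlgebra ℝ (K x)]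
  [TopologicalSpace (TotalSpace F K)] [∀ x, TopologicalSpace (K x)]
  [FiberBundle F K] [VectorBundle ℝ F K]

/-- A local trivialization of the vector bundle `K`, with model fiber `F ≃ g`, that is a
homomorphism of Lie algebras `K_y → g` on every fiber over its base set. -/
structure LieTrivialization where
  /-- a local trivialization in the atlas of the vector bundle -/
  triv : Trivialization F (π F K)
  mem_atlas : MemTrivializationAtlas triv
  /-- identification of the normed model fiber with the Lie algebra `g` -/
  toLie : F ≃ₗ[ℝ] g
  map_lie : ∀ y ∈ triv.baseSet, ∀ v w : K y,
    toLie (triv ⟨y, ⁅v, w⁆⟩).2 = ⁅toLie (triv ⟨y, v⟩).2, toLie (triv ⟨y, w⟩).2⁆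

attribute [instance] LieTrivialization.mem_atlas

/-- The vector bundle `K`, whose fibers are Lie algebras, is a Lie algebra bundle with typical
fiber `g`: local trivializations in its atlas that are fiberwise Lie algebra homomorphisms
to `g` cover the base. -/
class IsLieAlgebraBundle {M : Type*} [TopologicalSpace M]
    (F : Type*) [NormedAddCommGroup F] [NormedSpace ℝ F]
    (g : outParam Type*) [LieRing g] [LieAlgebra ℝ g]
    (K : M → Type*) [∀ x, LieRing (K x)] [∀ x, LieAlgebra ℝ (K x)]
    [TopologicalSpace (TotalSpace F K)] [∀ x, TopologicalSpace (K x)]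
    [FiberBundle F K] [VectorBundle ℝ F K] : Prop where
  exists_triv : ∀ x : M, ∃ t : LieTrivialization F g K, x ∈ t.triv.baseSet

variable {F g K}

namespace LieTrivialization

variable (t t' : LieTrivialization F g K)

/-- The Lie algebra homomorphism `K_y → g` given by a Lie trivialization (zero outside the
base set). -/
def hom (y : M) : K y →ₗ⁅ℝ⁆ g :=
  { (t.toLie : F →ₗ[ℝ] g) ∘ₗ t.triv.linearMapAt ℝ y with
    map_lie' := by
      intro v w
      by_cases hy : y ∈ t.triv.baseSet
      · simpa [t.triv.linearMapAt_apply, hy] using t.map_lie y hy v w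
      · simp [t.triv.linearMapAt_apply, hy] }

lemma hom_apply (y : M) (v : K y) : t.hom y v = t.toLie (t.triv.linearMapAt ℝ y v) := rfl

lemma hom_apply_of_mem {y : M} (hy : y ∈ t.triv.baseSet) (v : K y) :
    t.hom y v = t.toLie (t.triv ⟨y, v⟩).2 := by
  rw [hom_apply, t.triv.coe_linearMapAt_of_mem hy]

/-- The inverse `g → K_y` of `LieTrivialization.hom` (zero outside the base set). -/
def inv (y : M) : g →ₗ⁅ℝ⁆ K y :=
  { t.triv.symmₗ ℝ y ∘ₗ (t.toLie.symm : g →ₗ[ℝ] F) with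
    map_lie' := by
      intro v w
      by_cases hy : y ∈ t.triv.baseSet
      · have h : Function.Injective (t.triv.linearMapAt ℝ y) := by
          rw [t.triv.linearMapAt_def_of_mem hy]
          exact (t.triv.linearEquivAt ℝ y hy).injective
        apply h
        apply t.toLie.injective
        have := (t.hom y).map_lie (t.triv.symmₗ ℝ y (t.toLie.symm v))
          (t.triv.symmₗ ℝ y (t.toLie.symm w))
        simp only [hom_apply] at this
        simp only [AddHom.toFun_eq_coe, LinearMap.coe_toAddHom, LinearMap.comp_apply,
          LinearEquiv.coe_coe]
        rw [this]
        simp [t.triv.linearMapAt_symmₗ hy]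
      · simp [t.triv.symmₗ_apply_of_notMem hy] }

lemma inv_apply (y : M) (a : g) : t.inv y a = t.triv.symmₗ ℝ y (t.toLie.symm a) := rfl

lemma hom_inv {y : M} (hy : y ∈ t.triv.baseSet) (a : g) : t.hom y (t.inv y a) = a := by
  simp [hom_apply, inv_apply, t.triv.linearMapAt_symmₗ hy]

lemma inv_hom {y : M} (hy : y ∈ t.triv.baseSet) (v : K y) : t.inv y (t.hom y v) = v := by
  simp [hom_apply, inv_apply, t.triv.symmₗ_linearMapAt hy]

end LieTrivialization

end LieAlgebraBundle

/-! ### The vector bundle `V(K)` with fibers `V(K_x)` -/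

/-- The fibers `V(K_x)` of the bundle `V(K)`. The model fiber `F` of `K` and the typical fiber `g`
are recorded since the bundle structure depends on the bundle structure of `K`. -/
@[nolint unusedArguments]
def UniversalFormFiber {M : Type*} (_F : Type*) (_g : Type*) (K : M → Type*)
    [∀ x, LieRing (K x)] [∀ x, LieAlgebra ℝ (K x)] (x : M) : Type _ :=
  UniversalFormSpace (K x)

section UniversalFormBundle

variable {M : Type*} [TopologicalSpace M]
  (F : Type*) [NormedAddCommGroup F] [NormedSpace ℝ F]
  (g : Type*) [LieRing g] [LieAlgebra ℝ g] [FiniteDimensional ℝ g]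
  (K : M → Type*) [∀ x, LieRing (K x)] [∀ x, LieAlgebra ℝ (K x)]

instance (x : M) : AddCommGroup (UniversalFormFiber F g K x) :=
  inferInstanceAs (AddCommGroup (UniversalFormSpace (K x)))

instance (x : M) : Module ℝ (UniversalFormFiber F g K x) :=
  inferInstanceAs (Module ℝ (UniversalFormSpace (K x)))

/-- The fibers carry their canonical vector space topology. -/
instance (x : M) : TopologicalSpace (UniversalFormFiber F g K x) :=
  moduleTopology ℝ (UniversalFormFiber F g K x)

instance (x : M) : IsModuleTopology ℝ (UniversalFormFiber F g K x) := ⟨rfl⟩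

instance (x : M) : IsTopologicalAddGroup (UniversalFormFiber F g K x) :=
  IsModuleTopology.topologicalAddGroup ℝ _

instance (x : M) : ContinuousSMul ℝ (UniversalFormFiber F g K x) :=
  inferInstance

variable {F g K}
variable [TopologicalSpace (TotalSpace F K)] [∀ x, TopologicalSpace (K x)]
  [FiberBundle F K] [VectorBundle ℝ F K]

namespace LieTrivialization

/-- The linear map `V(K_y) → V(g)`, in coordinates on `V(g)`, induced by a Lie trivialization. -/
def formHom (t : LieTrivialization F g K) (y : M) :
    UniversalFormFiber F g K y →ₗ[ℝ] UniversalFormModel g :=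
  (universalFormCoord g : _ →ₗ[ℝ] _) ∘ₗ UniversalFormSpace.map (t.hom y)

/-- The inverse of `LieTrivialization.formHom` over the base set. -/
def formInv (t : LieTrivialization F g K) (y : M) :
    UniversalFormModel g →ₗ[ℝ] UniversalFormFiber F g K y :=
  UniversalFormSpace.map (t.inv y) ∘ₗ ((universalFormCoord g).symm : _ →ₗ[ℝ] _)

lemma formHom_formInv (t : LieTrivialization F g K) {y : M} (hy : y ∈ t.triv.baseSet)
    (a : UniversalFormModel g) : t.formHom y (t.formInv y a) = a := by
  have h := UniversalFormSpace.map_eq_self ((t.hom y).comp (t.inv y)) (fun a => t.hom_inv hy a)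
    ((universalFormCoord g).symm a)
  rw [← UniversalFormSpace.map_map] at h
  exact (congrArg (universalFormCoord g) h).trans (LinearEquiv.apply_symm_apply _ _)

lemma formInv_formHom (t : LieTrivialization F g K) {y : M} (hy : y ∈ t.triv.baseSet)
    (u : UniversalFormFiber F g K y) : t.formInv y (t.formHom y u) = u := by
  have h := UniversalFormSpace.map_eq_self ((t.inv y).comp (t.hom y)) (fun a => t.inv_hom hy a) u
  refine Eq.trans ?_ ((UniversalFormSpace.map_map (t.hom y) (t.inv y) u).trans h)
  exact congrArg (UniversalFormSpace.map (t.inv y)) (LinearEquiv.symm_apply_apply _ _)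

/-- The local trivialization of `V(K)` induced by a Lie trivialization of `K`. -/
def formPretriv (t : LieTrivialization F g K) :
    Pretrivialization (UniversalFormModel g)
      (π (UniversalFormModel g) (UniversalFormFiber F g K)) where
  toFun p := ⟨p.1, t.formHom p.1 p.2⟩
  invFun p := ⟨p.1, t.formInv p.1 p.2⟩
  source := TotalSpace.proj ⁻¹' t.triv.baseSet
  target := t.triv.baseSet ×ˢ univ
  map_source' := fun ⟨_, _⟩ h ↦ ⟨h, mem_univ _⟩
  map_target' := fun ⟨_, _⟩ h ↦ h.1
  left_inv' := by
    rintro ⟨x, u⟩ h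
    exact congrArg (TotalSpace.mk x) (t.formInv_formHom h u)
  right_inv' := by
    rintro ⟨x, u⟩ h
    exact congrArg (Prod.mk x) (t.formHom_formInv h.1 u)
  open_target := t.triv.open_baseSet.prod isOpen_univ
  baseSet := t.triv.baseSet
  open_baseSet := t.triv.open_baseSet
  source_eq := rfl
  target_eq := rfl
  proj_toFun _ _ := rfl

lemma formPretriv_apply (t : LieTrivialization F g K) (y : M) (u : UniversalFormFiber F g K y) :
    t.formPretriv ⟨y, u⟩ = (y, t.formHom y u) := rfl

lemma formPretriv_symm (t : LieTrivialization F g K) {y : M} (hy : y ∈ t.triv.baseSet)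
    (a : UniversalFormModel g) : t.formPretriv.symm y a = t.formInv y a := by
  rw [Pretrivialization.symm_apply _ (show y ∈ t.formPretriv.baseSet from hy)]
  rfl

instance (t : LieTrivialization F g K) : t.formPretriv.IsLinear ℝ where
  linear x _ :=
    { map_add := fun u v => (t.formHom x).map_add u v
      map_smul := fun c u => (t.formHom x).map_smul c u }

/-- The model fiber is finite-dimensional as soon as there is a Lie trivialization. -/
lemma finiteDimensional (t : LieTrivialization F g K) : FiniteDimensional ℝ F :=
  t.toLie.symm.finiteDimensional

/-- The coordinate change of `V(K)` between two Lie trivializations as a quadratic expression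
in the coordinate change of `K`. -/
def formCoordChangeAux (t t' : LieTrivialization F g K) :
    (F →L[ℝ] F) →ₗ[ℝ] (F →L[ℝ] F) →ₗ[ℝ]
      (UniversalFormModel g →L[ℝ] UniversalFormModel g) :=
  let s := ((invariantRelations g).mkQ.exists_rightInverse_of_surjective
    (Submodule.range_mkQ _)).choose
  let c : (F →L[ℝ] F) →ₗ[ℝ] (g →ₗ[ℝ] g) :=
    (t.toLie.arrowCongr t'.toLie).toLinearMap ∘ₗ
      ContinuousLinearMap.coeLM ℝ
  let m : (g ⊗[ℝ] g →ₗ[ℝ] g ⊗[ℝ] g) →ₗ[ℝ]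
      (UniversalFormModel g →L[ℝ] UniversalFormModel g) :=
    (LinearMap.toContinuousLinearMap : _ ≃ₗ[ℝ] _).toLinearMap ∘ₗ
    (LinearMap.lcomp ℝ _ (s ∘ₗ ((universalFormCoord g).symm : _ →ₗ[ℝ] _))) ∘ₗ
      (LinearMap.llcomp ℝ _ _ _
        ((universalFormCoord g : _ →ₗ[ℝ] _) ∘ₗ (invariantRelations g).mkQ))
  ((TensorProduct.mapBilinear (RingHom.id ℝ) g g g g).compl₁₂ c c).compr₂ m

lemma formCoordChangeAux_apply (t t' : LieTrivialization F g K) {y : M}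
    (hy : y ∈ t.triv.baseSet ∩ t'.triv.baseSet) (a : UniversalFormModel g) :
    formCoordChangeAux t t' (t.triv.coordChangeL ℝ t'.triv y : F →L[ℝ] F)
      (t.triv.coordChangeL ℝ t'.triv y : F →L[ℝ] F) a = t'.formHom y (t.formInv y a) := by
  have hs := ((invariantRelations g).mkQ.exists_rightInverse_of_surjective
    (Submodule.range_mkQ _)).choose_spec
  set s := ((invariantRelations g).mkQ.exists_rightInverse_of_surjective
    (Submodule.range_mkQ _)).choose with hsdef
  have hs' : ∀ v, (invariantRelations g).mkQ (s v) = v := fun v => LinearMap.congr_fun hs v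
  have hA : (t.toLie.arrowCongr t'.toLie)
      ((t.triv.coordChangeL ℝ t'.triv y : F →L[ℝ] F) : F →ₗ[ℝ] F) =
        (((t'.hom y).comp (t.inv y) : g →ₗ⁅ℝ⁆ g) : g →ₗ[ℝ] g) := by
    ext v
    simp [LinearEquiv.arrowCongr_apply, hom_apply, inv_apply,
      Trivialization.coordChangeL_apply _ _ hy, t'.triv.linearMapAt_apply, hy.2,
      t.triv.symmₗ_apply hy.1]
  have hR : t'.formHom y (t.formInv y a) =
      universalFormCoord g ((invariantRelations g).mkQ
        (TensorProduct.map (((t'.hom y).comp (t.inv y) : g →ₗ⁅ℝ⁆ g) : g →ₗ[ℝ] g)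
          (((t'.hom y).comp (t.inv y) : g →ₗ⁅ℝ⁆ g) : g →ₗ[ℝ] g)
          (s ((universalFormCoord g).symm a)))) := by
    rw [← UniversalFormSpace.map_mkQ, hs', ← UniversalFormSpace.map_map]
    rfl
  rw [hR, ← hA]
  rfl

lemma contDiff_formCoordChangeAux (t t' : LieTrivialization F g K) :
    ContDiff ℝ ∞ (fun C : F →L[ℝ] F => formCoordChangeAux t t' C C) := by
  have := t.finiteDimensional
  generalize formCoordChangeAux t t' = A
  have h := A.toContinuousBilinearMap.isBoundedBilinearMap.contDiff (n := ∞)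
  exact h.comp (contDiff_id.prodMk contDiff_id)

end LieTrivialization

variable (F g K) in
/-- The vector bundle structure of `V(K)`: its atlas consists of the local trivializations
induced by the Lie trivializations of `K`. -/
def universalFormPrebundle [IsLieAlgebraBundle F g K] :
    VectorPrebundle ℝ (UniversalFormModel g) (UniversalFormFiber F g K) where
  pretrivializationAtlas := range LieTrivialization.formPretriv
  pretrivialization_linear' := by
    rintro _ ⟨t, rfl⟩
    infer_instance
  pretrivializationAt x :=
    (IsLieAlgebraBundle.exists_triv (F := F) (g := g) (K := K) x).choose.formPretriv
  mem_base_pretrivializationAt x :=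
    (IsLieAlgebraBundle.exists_triv (F := F) (g := g) (K := K) x).choose_spec
  pretrivialization_mem_atlas x := ⟨_, rfl⟩
  exists_coordChange := by
    rintro _ ⟨t, rfl⟩ _ ⟨t', rfl⟩
    refine ⟨fun y => t.formCoordChangeAux t' (t.triv.coordChangeL ℝ t'.triv y : F →L[ℝ] F)
      (t.triv.coordChangeL ℝ t'.triv y : F →L[ℝ] F), ?_, ?_⟩
    · exact (t.contDiff_formCoordChangeAux t').continuous.comp_continuousOn
        (VectorBundle.continuousOn_coordChange' t.triv t'.triv)
    · intro y hy a
      rw [t.formPretriv_symm hy.1, LieTrivialization.formPretriv_apply]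
      exact t.formCoordChangeAux_apply t' hy a
  totalSpaceMk_isInducing := by
    intro x
    set t := (IsLieAlgebraBundle.exists_triv (F := F) (g := g) (K := K) x).choose with ht
    have hx : x ∈ t.triv.baseSet :=
      (IsLieAlgebraBundle.exists_triv (F := F) (g := g) (K := K) x).choose_spec
    have h1 : Continuous (t.formHom x) := IsModuleTopology.continuous_of_linearMap _
    have h2 : Continuous (t.formInv x) := IsModuleTopology.continuous_of_linearMap _
    let φ : UniversalFormFiber F g K x ≃ₜ UniversalFormModel g :=
      { toFun := t.formHom x
        invFun := t.formInv x
        left_inv := t.formInv_formHom hx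
        right_inv := t.formHom_formInv hx
        continuous_toFun := h1
        continuous_invFun := h2 }
    exact isInducing_const_prod.mpr φ.isInducing

instance [IsLieAlgebraBundle F g K] :
    TopologicalSpace (TotalSpace (UniversalFormModel g) (UniversalFormFiber F g K)) :=
  (universalFormPrebundle F g K).totalSpaceTopology

instance [IsLieAlgebraBundle F g K] :
    FiberBundle (UniversalFormModel g) (UniversalFormFiber F g K) :=
  (universalFormPrebundle F g K).toFiberBundle

instance [IsLieAlgebraBundle F g K] :
    VectorBundle ℝ (UniversalFormModel g) (UniversalFormFiber F g K) :=
  (universalFormPrebundle F g K).toVectorBundle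

/-- The trivialization of `V(K)` that comes from a Lie trivialization of `K`. -/
def LieTrivialization.formTriv [IsLieAlgebraBundle F g K] (t : LieTrivialization F g K) :
    Trivialization (UniversalFormModel g)
      (π (UniversalFormModel g) (UniversalFormFiber F g K)) :=
  (universalFormPrebundle F g K).trivializationOfMemPretrivializationAtlas ⟨t, rfl⟩

instance [IsLieAlgebraBundle F g K] (t : LieTrivialization F g K) :
    MemTrivializationAtlas t.formTriv where
  out := ⟨_, ⟨t, rfl⟩, rfl⟩

lemma LieTrivialization.formTriv_apply [IsLieAlgebraBundle F g K] (t : LieTrivialization F g K)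
    (y : M) (u : UniversalFormFiber F g K y) : t.formTriv ⟨y, u⟩ = (y, t.formHom y u) := rfl

lemma LieTrivialization.formTriv_baseSet [IsLieAlgebraBundle F g K]
    (t : LieTrivialization F g K) : t.formTriv.baseSet = t.triv.baseSet := rfl

end UniversalFormBundle

section Smooth

variable {E : Type*} [NormedAddCommGroup E] [NormedSpace ℝ E]
  {M : Type*} [TopologicalSpace M] [ChartedSpace E M]
  (F : Type*) [NormedAddCommGroup F] [NormedSpace ℝ F]
  (g : Type*) [LieRing g] [LieAlgebra ℝ g] [FiniteDimensional ℝ g]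
  (K : M → Type*) [∀ x, LieRing (K x)] [∀ x, LieAlgebra ℝ (K x)]
  [TopologicalSpace (TotalSpace F K)] [∀ x, TopologicalSpace (K x)]
  [FiberBundle F K] [VectorBundle ℝ F K] [ContMDiffVectorBundle ∞ F K 𝓘(ℝ, E)]
  [IsLieAlgebraBundle F g K]

instance : (universalFormPrebundle F g K).IsContMDiff 𝓘(ℝ, E) ∞ where
  exists_contMDiffCoordChange := by
    rintro _ ⟨t, rfl⟩ _ ⟨t', rfl⟩
    refine ⟨fun y => t.formCoordChangeAux t' (t.triv.coordChangeL ℝ t'.triv y : F →L[ℝ] F)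
      (t.triv.coordChangeL ℝ t'.triv y : F →L[ℝ] F), ?_, ?_⟩
    · exact (t.contDiff_formCoordChangeAux t').contMDiff.comp_contMDiffOn
        (contMDiffOn_coordChangeL t.triv t'.triv)
    · intro y hy a
      rw [t.formPretriv_symm hy.1, LieTrivialization.formPretriv_apply]
      exact t.formCoordChangeAux_apply t' hy a

instance : ContMDiffVectorBundle ∞ (UniversalFormModel g) (UniversalFormFiber F g K) 𝓘(ℝ, E) :=
  (universalFormPrebundle F g K).contMDiffVectorBundle 𝓘(ℝ, E)

end Smooth

/-! ### Compactly supported smooth sections and one-forms -/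

section Sections

variable (E : Type*) [NormedAddCommGroup E] [NormedSpace ℝ E]
  {M : Type*} [TopologicalSpace M] [ChartedSpace E M]
  (F : Type*) [NormedAddCommGroup F] [NormedSpace ℝ F]
  (V : M → Type*) [∀ x, AddCommGroup (V x)] [∀ x, Module ℝ (V x)]
  [TopologicalSpace (TotalSpace F V)] [∀ x, TopologicalSpace (V x)]
  [FiberBundle F V] [VectorBundle ℝ F V]

/-- The space `C^∞(M, V)` of smooth sections of a vector bundle `V`. -/
abbrev SmoothSection : Type _ := ContMDiffSection 𝓘(ℝ, E) F ∞ V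

variable {V} in
/-- The support of a section. -/
def sectionSupport (s : ∀ x, V x) : Set M := closure {x | s x ≠ 0}

variable {F V} in
/-- The local representation of a section in a local trivialization `e` and a chart `φ`. -/
def localRep (e : Trivialization F (π F V)) (φ : OpenPartialHomeomorph M E) (s : ∀ x, V x) :
    E → F :=
  fun z => (e ⟨φ.symm z, s (φ.symm z)⟩).2

/-- The topology of `C^∞(M, V)`: uniform convergence on compact sets of all derivatives of the
local representations. -/
@[reducible]
def smoothSectionTopology : TopologicalSpace (SmoothSection E F V) :=
  ⨅ e ∈ trivializationAtlas F V, ⨅ φ ∈ atlas E M, ⨅ n : ℕ,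
    TopologicalSpace.induced
      (fun s : SmoothSection E F V =>
        UniformOnFun.ofFun {C : Set E | IsCompact C ∧ C ⊆ φ.target ∩ φ.symm ⁻¹' e.baseSet}
          (iteratedFDeriv ℝ n (localRep E e φ s)))
      (UniformOnFun.topologicalSpace E (E [×n]→L[ℝ] F) _)

/-- The subspace of compactly supported sections in `C^∞(M, V)`. -/
def compactSectionSubmodule : Submodule ℝ (SmoothSection E F V) where
  carrier := {s | IsCompact (sectionSupport s)}
  zero_mem' := by simp [sectionSupport]
  add_mem' := by
    intro s t hs ht
    refine (hs.union ht).of_isClosed_subset isClosed_closure ?_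
    refine (closure_mono ?_).trans closure_union.subset
    intro x hx
    by_contra h
    simp only [mem_union, mem_ofPred_eq, not_or, not_not] at h
    exact hx (by simp [h.1, h.2])
  smul_mem' := by
    intro c s hs
    refine hs.of_isClosed_subset isClosed_closure (closure_mono fun x hx => ?_)
    intro h
    exact hx (by simp [h])

/-- The space `C_c^∞(M, V)` of compactly supported smooth sections. -/
def CompactSection : Type _ := compactSectionSubmodule E F V

namespace CompactSection

instance : AddCommGroup (CompactSection E F V) :=
  inferInstanceAs (AddCommGroup (compactSectionSubmodule E F V))

instance : Module ℝ (CompactSection E F V) :=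
  inferInstanceAs (Module ℝ (compactSectionSubmodule E F V))

variable {E F V}

instance : DFunLike (CompactSection E F V) M V where
  coe s := s.1
  coe_injective _ _ h := Subtype.ext (DFunLike.coe_injective h)

/-- A compactly supported smooth section from a function, its smoothness and the compactness of
its support. -/
def mk (s : ∀ x, V x)
    (hs : ContMDiff 𝓘(ℝ, E) (𝓘(ℝ, E).prod 𝓘(ℝ, F)) ∞ fun x => TotalSpace.mk' F x (s x))
    (hc : IsCompact (sectionSupport s)) : CompactSection E F V :=
  ⟨⟨s, hs⟩, hc⟩

@[simp] lemma mk_apply (s : ∀ x, V x)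
    (hs : ContMDiff 𝓘(ℝ, E) (𝓘(ℝ, E).prod 𝓘(ℝ, F)) ∞ fun x => TotalSpace.mk' F x (s x))
    (hc : IsCompact (sectionSupport s)) (x : M) : mk s hs hc x = s x := rfl

@[ext] lemma ext {s t : CompactSection E F V} (h : ∀ x, s x = t x) : s = t :=
  DFunLike.ext _ _ h

@[simp] lemma add_apply (s t : CompactSection E F V) (x : M) : (s + t) x = s x + t x := rfl
@[simp] lemma zero_apply (x : M) : (0 : CompactSection E F V) x = 0 := rfl
@[simp] lemma neg_apply (s : CompactSection E F V) (x : M) : (-s) x = -s x := rfl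
@[simp] lemma sub_apply (s t : CompactSection E F V) (x : M) : (s - t) x = s x - t x := rfl
@[simp] lemma smul_apply (c : ℝ) (s : CompactSection E F V) (x : M) : (c • s) x = c • s x := rfl

lemma contMDiff (s : CompactSection E F V) :
    ContMDiff 𝓘(ℝ, E) (𝓘(ℝ, E).prod 𝓘(ℝ, F)) ∞ fun x => TotalSpace.mk' F x (s x) :=
  s.1.contMDiff

lemma isCompact_support (s : CompactSection E F V) : IsCompact (sectionSupport s) := s.2

/-- A section that vanishes wherever a compactly supported section does is compactly
supported. -/
lemma isCompact_support_of {F' : Type*} [NormedAddCommGroup F'] [NormedSpace ℝ F']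
    {V' : M → Type*} [∀ x, AddCommGroup (V' x)] (s : CompactSection E F V) {u : ∀ x, V' x}
    (h : ∀ x, s x = 0 → u x = 0) : IsCompact (sectionSupport u) :=
  s.isCompact_support.of_isClosed_subset isClosed_closure
    (closure_mono fun x hx h' => hx (h x h'))

/-- Multiplication of a compactly supported section by a smooth function. -/
instance : SMul C^∞⟮𝓘(ℝ, E), M; 𝓘(ℝ), ℝ⟯ (CompactSection E F V) where
  smul f s := mk (fun x => f x • s x) (f.contMDiff.smul_section s.contMDiff)
    (s.isCompact_support_of (F' := F) fun x hx => by rw [hx, smul_zero])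

@[simp] lemma fun_smul_apply (f : C^∞⟮𝓘(ℝ, E), M; 𝓘(ℝ), ℝ⟯) (s : CompactSection E F V) (x : M) :
    (f • s) x = f x • s x := rfl

variable (E F V) in
/-- The space `C_C^∞(M, V)` of smooth sections with support in the compact set `C`. -/
def SupportedIn (C : TopologicalSpace.Compacts M) : Type _ :=
  {s : SmoothSection E F V // sectionSupport s ⊆ C}

/-- `C_C^∞(M, V)` carries the subspace topology of `C^∞(M, V)`. -/
instance (C : TopologicalSpace.Compacts M) : TopologicalSpace (SupportedIn E F V C) :=
  TopologicalSpace.induced Subtype.val (smoothSectionTopology E F V)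

/-- The inclusion of `C_C^∞(M, V)` in `C_c^∞(M, V)`. -/
def ofSupportedIn {C : TopologicalSpace.Compacts M} (s : SupportedIn E F V C) :
    CompactSection E F V :=
  ⟨s.1, C.isCompact.of_isClosed_subset isClosed_closure s.2⟩

/-- The topology of `C_c^∞(M, V)`: the inductive limit of the spaces `C_C^∞(M, V)` in the category
of locally convex spaces, i.e. the finest locally convex topology for which the inclusions of the
spaces `C_C^∞(M, V)`, with `C` compact, are continuous. -/
instance : TopologicalSpace (CompactSection E F V) :=
  sInf {t : TopologicalSpace (CompactSection E F V) |
    (∀ C : TopologicalSpace.Compacts M,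
      Continuous[inferInstance, t] (ofSupportedIn : SupportedIn E F V C → CompactSection E F V)) ∧
    @IsTopologicalAddGroup (CompactSection E F V) t _ ∧
    @ContinuousSMul ℝ (CompactSection E F V) _ _ t ∧
    @LocallyConvexSpace ℝ (CompactSection E F V) _ _ _ _ t}

instance : IsTopologicalAddGroup (CompactSection E F V) :=
  topologicalAddGroup_sInf fun _ ⟨_, ht, _, _⟩ ↦ ht

instance : ContinuousSMul ℝ (CompactSection E F V) :=
  continuousSMul_sInf fun _ ⟨_, _, ht, _⟩ ↦ ht

instance : LocallyConvexSpace ℝ (CompactSection E F V) :=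
  .sInf fun _ ⟨_, _, _, ht⟩ ↦ ht

end CompactSection

variable [IsManifold 𝓘(ℝ, E) ∞ M] [∀ x, IsTopologicalAddGroup (V x)]
  [∀ x, ContinuousSMul ℝ (V x)]

/-- The space `Ω_c^1(M, V)` of compactly supported `V`-valued one-forms, i.e. of compactly
supported smooth sections of the bundle `Hom(TM, V)`. -/
abbrev CompactOneForm : Type _ :=
  CompactSection E (E →L[ℝ] F) (fun x : M => TangentSpace 𝓘(ℝ, E) x →L[ℝ] V x)

variable {E F V}

/-- A linear map `d : C_c^∞(M, V) → Ω_c^1(M, V)` is a Koszul connection if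
`d (f η) = f dη + η df` for all smooth functions `f` on `M`. -/
def IsKoszulConnection (d : CompactSection E F V →ₗ[ℝ] CompactOneForm E F V) : Prop :=
  ∀ (f : C^∞⟮𝓘(ℝ, E), M; 𝓘(ℝ), ℝ⟯) (η : CompactSection E F V) (p : M)
    (v : TangentSpace 𝓘(ℝ, E) p),
    d (f • η) p v = f p • d η p v + mvfderiv 𝓘(ℝ, E) f p v • η p

end Sections

/-! ### Lie connections and the forms `κ_K` and `κ̃_K` -/

section LieSections

variable {E : Type*} [NormedAddCommGroup E] [NormedSpace ℝ E] [FiniteDimensional ℝ E]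
  {M : Type*} [TopologicalSpace M] [ChartedSpace E M] [IsManifold 𝓘(ℝ, E) ∞ M]
  {F : Type*} [NormedAddCommGroup F] [NormedSpace ℝ F]
  {g : Type*} [LieRing g] [LieAlgebra ℝ g] [FiniteDimensional ℝ g]
  {K : M → Type*} [∀ x, LieRing (K x)] [∀ x, LieAlgebra ℝ (K x)]
  [TopologicalSpace (TotalSpace F K)] [∀ x, TopologicalSpace (K x)]
  [FiberBundle F K] [VectorBundle ℝ F K] [ContMDiffVectorBundle ∞ F K 𝓘(ℝ, E)]

/-- A bilinear expression in smooth maps to finite-dimensional spaces is smooth. -/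
lemma contMDiffAt_bilinear {A B C : Type*} [NormedAddCommGroup A] [NormedSpace ℝ A]
    [NormedAddCommGroup B] [NormedSpace ℝ B] [NormedAddCommGroup C] [NormedSpace ℝ C]
    [FiniteDimensional ℝ A] [FiniteDimensional ℝ B] (b : A →ₗ[ℝ] B →ₗ[ℝ] C) {x : M}
    {u : M → A} {v : M → B} (hu : ContMDiffAt 𝓘(ℝ, E) 𝓘(ℝ, A) ∞ u x)
    (hv : ContMDiffAt 𝓘(ℝ, E) 𝓘(ℝ, B) ∞ v x) :
    ContMDiffAt 𝓘(ℝ, E) 𝓘(ℝ, C) ∞ (fun y => b (u y) (v y)) x := by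
  have h := b.toContinuousBilinearMap.isBoundedBilinearMap.contDiff (n := ∞)
  exact h.contMDiff.contMDiffAt.comp x (hu.prodMk_space hv)

lemma CompactSection.contMDiff_lie [IsLieAlgebraBundle F g K] (s t : CompactSection E F K) :
    ContMDiff 𝓘(ℝ, E) (𝓘(ℝ, E).prod 𝓘(ℝ, F)) ∞
      fun x => TotalSpace.mk' F x (⁅s x, t x⁆ : K x) := by
  intro x
  obtain ⟨τ, hτ⟩ := IsLieAlgebraBundle.exists_triv (F := F) (g := g) (K := K) x
  have := τ.finiteDimensional
  have hs := (τ.triv.contMDiffAt_section_iff hτ).1 (s.contMDiff x)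
  have ht := (τ.triv.contMDiffAt_section_iff hτ).1 (t.contMDiff x)
  rw [τ.triv.contMDiffAt_section_iff hτ]
  have h := contMDiffAt_bilinear
    (((LieModule.toEnd ℝ g g : g →ₗ[ℝ] g →ₗ[ℝ] g).compl₁₂ (τ.toLie : F →ₗ[ℝ] g)
      (τ.toLie : F →ₗ[ℝ] g)).compr₂ (τ.toLie.symm : g →ₗ[ℝ] F)) hs ht
  refine h.congr_of_eventuallyEq ?_
  filter_upwards [τ.triv.open_baseSet.mem_nhds hτ] with y hy
  simp [← τ.map_lie y hy]

variable [IsLieAlgebraBundle F g K]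

/-- The pointwise Lie bracket `[s, t](x) = [s(x), t(x)]` of sections. -/
instance : Bracket (CompactSection E F K) (CompactSection E F K) where
  bracket s t := CompactSection.mk (fun x => ⁅s x, t x⁆) (CompactSection.contMDiff_lie s t)
    (s.isCompact_support_of (F' := F) fun x hx => by rw [hx, zero_lie])

@[simp] lemma CompactSection.lie_apply (s t : CompactSection E F K) (x : M) :
    ⁅s, t⁆ x = ⁅s x, t x⁆ := rfl

instance : LieRing (CompactSection E F K) where
  add_lie _ _ _ := CompactSection.ext fun _ => add_lie _ _ _
  lie_add _ _ _ := CompactSection.ext fun _ => lie_add _ _ _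
  lie_self _ := CompactSection.ext fun _ => lie_self _
  leibniz_lie _ _ _ := CompactSection.ext fun _ => leibniz_lie _ _ _

instance : LieAlgebra ℝ (CompactSection E F K) where
  lie_smul _ _ _ := CompactSection.ext fun _ => lie_smul _ _ _

/-- In coordinates given by a Lie trivialization, `κ` on the fibers is `κ_g`. -/
def LieTrivialization.formBilin (τ : LieTrivialization F g K) :
    F →ₗ[ℝ] F →ₗ[ℝ] UniversalFormModel g :=
  ((universalForm g).compl₁₂ (τ.toLie : F →ₗ[ℝ] g) (τ.toLie : F →ₗ[ℝ] g)).compr₂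
    (universalFormCoord g : _ →ₗ[ℝ] _)

variable (F g K) in
/-- The universal invariant symmetric bilinear form `κ_{K_x} : K_x × K_x → V(K_x)`. -/
def fiberForm (x : M) : K x →ₗ[ℝ] K x →ₗ[ℝ] UniversalFormFiber F g K x :=
  universalForm (K x)

lemma LieTrivialization.formHom_fiberForm (τ : LieTrivialization F g K) {y : M}
    (hy : y ∈ τ.triv.baseSet) (v w : K y) :
    τ.formHom y (fiberForm F g K y v w) =
      τ.formBilin (τ.triv ⟨y, v⟩).2 (τ.triv ⟨y, w⟩).2 := by
  rw [formBilin, LinearMap.compr₂_apply, LinearMap.compl₁₂_apply]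
  simp only [LinearEquiv.coe_coe]
  rw [← τ.hom_apply_of_mem hy, ← τ.hom_apply_of_mem hy]
  rfl

lemma CompactSection.contMDiff_form (s t : CompactSection E F K) :
    ContMDiff 𝓘(ℝ, E) (𝓘(ℝ, E).prod 𝓘(ℝ, UniversalFormModel g)) ∞
      fun x => TotalSpace.mk' (UniversalFormModel g) x (fiberForm F g K x (s x) (t x)) := by
  intro x
  obtain ⟨τ, hτ⟩ := IsLieAlgebraBundle.exists_triv (F := F) (g := g) (K := K) x
  have := τ.finiteDimensional
  have hs := (τ.triv.contMDiffAt_section_iff hτ).1 (s.contMDiff x)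
  have ht := (τ.triv.contMDiffAt_section_iff hτ).1 (t.contMDiff x)
  rw [τ.formTriv.contMDiffAt_section_iff hτ]
  refine (contMDiffAt_bilinear τ.formBilin hs ht).congr_of_eventuallyEq ?_
  filter_upwards [τ.triv.open_baseSet.mem_nhds hτ] with y hy
  exact τ.formHom_fiberForm hy _ _

variable (E F g K) in
/-- The map `κ_K : C_c^∞(M, K) × C_c^∞(M, K) → C_c^∞(M, V(K))`,
`κ_K(s, t)(x) = κ_{K_x}(s(x), t(x))`. -/
def sectionForm : CompactSection E F K →ₗ[ℝ] CompactSection E F K →ₗ[ℝ]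
    CompactSection E (UniversalFormModel g) (UniversalFormFiber F g K) :=
  LinearMap.mk₂ ℝ
    (fun s t => CompactSection.mk (fun x => fiberForm F g K x (s x) (t x))
      (CompactSection.contMDiff_form s t)
      (s.isCompact_support_of (F' := UniversalFormModel g) fun x hx => by
        rw [hx, map_zero, LinearMap.zero_apply]))
    (fun s s' t => CompactSection.ext fun x => (fiberForm F g K x).map_add₂ _ _ _)
    (fun c s t => CompactSection.ext fun x => (fiberForm F g K x).map_smul₂ _ _ _)
    (fun s t t' => CompactSection.ext fun x => (fiberForm F g K x (s x)).map_add _ _)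
    (fun c s t => CompactSection.ext fun x => (fiberForm F g K x (s x)).map_smul _ _)

@[simp] lemma sectionForm_apply (s t : CompactSection E F K) (x : M) :
    sectionForm E F g K s t x = fiberForm F g K x (s x) (t x) := rfl

variable [∀ x, IsTopologicalAddGroup (K x)] [∀ x, ContinuousSMul ℝ (K x)]

/-- The linear map `T_x M → V(K_x)`, `v ↦ κ_{K_x}(α(v), a)`. -/
def oneFormFiberForm (x : M) (α : TangentSpace 𝓘(ℝ, E) x →L[ℝ] K x) (a : K x) :
    TangentSpace 𝓘(ℝ, E) x →L[ℝ] UniversalFormFiber F g K x where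
  toLinearMap := (fiberForm F g K x).flip a ∘ₗ (α : TangentSpace 𝓘(ℝ, E) x →ₗ[ℝ] K x)
  cont := by
    have h : ∀ l : E →ₗ[ℝ] UniversalFormFiber F g K x, Continuous l :=
      fun l => l.continuous_of_finiteDimensional
    exact h ((fiberForm F g K x).flip a ∘ₗ (α : TangentSpace 𝓘(ℝ, E) x →ₗ[ℝ] K x))

@[simp] lemma oneFormFiberForm_apply (x : M) (α : TangentSpace 𝓘(ℝ, E) x →L[ℝ] K x) (a : K x)
    (v : TangentSpace 𝓘(ℝ, E) x) :
    oneFormFiberForm x α a v = fiberForm F g K x (α v) a := rfl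

lemma CompactSection.contMDiff_oneFormForm (α : CompactOneForm E F K)
    (s : CompactSection E F K) :
    ContMDiff 𝓘(ℝ, E) (𝓘(ℝ, E).prod 𝓘(ℝ, E →L[ℝ] UniversalFormModel g)) ∞
      fun x => TotalSpace.mk' (E →L[ℝ] UniversalFormModel g)
        (E := fun x : M => TangentSpace 𝓘(ℝ, E) x →L[ℝ] UniversalFormFiber F g K x) x
        (oneFormFiberForm x (α x) (s x)) := by
  intro x
  obtain ⟨τ, hτ⟩ := IsLieAlgebraBundle.exists_triv (F := F) (g := g) (K := K) x
  have := τ.finiteDimensional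
  set e := trivializationAt E (TangentSpace 𝓘(ℝ, E) : M → Type _) x with he
  have hx : x ∈ e.baseSet := mem_baseSet_trivializationAt E _ x
  have hα := ((e.continuousLinearMap (RingHom.id ℝ) τ.triv).contMDiffAt_section_iff
    ⟨hx, hτ⟩).1 (α.contMDiff x)
  have hs := (τ.triv.contMDiffAt_section_iff hτ).1 (s.contMDiff x)
  rw [(e.continuousLinearMap (RingHom.id ℝ) τ.formTriv).contMDiffAt_section_iff ⟨hx, hτ⟩]
  let b : (E →L[ℝ] F) →ₗ[ℝ] F →ₗ[ℝ] (E →L[ℝ] UniversalFormModel g) :=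
    LinearMap.mk₂ ℝ (fun A a => (LinearMap.toContinuousLinearMap
      (τ.formBilin.flip a ∘ₗ (A : E →ₗ[ℝ] F))))
      (fun A A' a => by ext; simp) (fun c A a => by ext; simp)
      (fun A a a' => by ext; simp) (fun c A a => by ext; simp)
  refine (contMDiffAt_bilinear b hα hs).congr_of_eventuallyEq ?_
  filter_upwards [τ.triv.open_baseSet.mem_nhds hτ] with y hy
  ext1 v
  have hy' : y ∈ τ.formTriv.baseSet := hy
  simp only [Trivialization.continuousLinearMap_apply, b, LinearMap.mk₂_apply,
    ContinuousLinearMap.comp_apply, LinearMap.coe_toContinuousLinearMap', LinearMap.comp_apply,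
    LinearMap.flip_apply, ContinuousLinearMap.coe_coe,
    Trivialization.continuousLinearMapAt_apply, Trivialization.linearMapAt_apply, if_pos hy,
    if_pos hy']
  exact τ.formHom_fiberForm hy _ _

variable (E F g K) in
/-- The map `κ̃_K : Ω_c^1(M, K) × C_c^∞(M, K) → Ω_c^1(M, V(K))`,
`κ̃_K(α, s)_x(v) = κ_{K_x}(α_x(v), s(x))`. -/
def oneFormForm : CompactOneForm E F K →ₗ[ℝ] CompactSection E F K →ₗ[ℝ]
    CompactOneForm E (UniversalFormModel g) (UniversalFormFiber F g K) :=
  LinearMap.mk₂ ℝ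
    (fun α s => CompactSection.mk (fun x => oneFormFiberForm x (α x) (s x))
      (CompactSection.contMDiff_oneFormForm α s)
      (s.isCompact_support_of (F' := E →L[ℝ] UniversalFormModel g) fun x hx => by
        ext v; simp [hx]))
    (fun α α' s => CompactSection.ext fun x => by ext v; simp)
    (fun c α s => CompactSection.ext fun x => by ext v; simp)
    (fun α s s' => CompactSection.ext fun x => by ext v; simp)
    (fun c α s => CompactSection.ext fun x => by ext v; simp)

@[simp] lemma oneFormForm_apply (α : CompactOneForm E F K) (s : CompactSection E F K) (x : M)
    (v : TangentSpace 𝓘(ℝ, E) x) :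
    oneFormForm E F g K α s x v = fiberForm F g K x (α x v) (s x) := rfl

/-- A Koszul connection `D` on a Lie algebra bundle is a Lie connection if
`D[η, τ] = [Dη, τ] + [η, Dτ]`. -/
def IsLieConnection (D : CompactSection E F K →ₗ[ℝ] CompactOneForm E F K) : Prop :=
  IsKoszulConnection D ∧
    ∀ (η τ : CompactSection E F K) (p : M) (v : TangentSpace 𝓘(ℝ, E) p),
      D ⁅η, τ⁆ p v = ⁅D η p v, τ p⁆ + ⁅η p, D τ p v⁆

/-- The symmetric bilinear form `β(ζ, η) = κ̃_K(Dζ, η) + κ̃_K(Dη, ζ)`, that is,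
`β(ζ, η)_x(v) = κ_{K_x}((Dζ)_x(v), η(x)) + κ_{K_x}(ζ(x), (Dη)_x(v))`. -/
def connectionForm (D : CompactSection E F K →ₗ[ℝ] CompactOneForm E F K) :
    CompactSection E F K →ₗ[ℝ] CompactSection E F K →ₗ[ℝ]
      CompactOneForm E (UniversalFormModel g) (UniversalFormFiber F g K) :=
  (oneFormForm E F g K) ∘ₗ D + ((oneFormForm E F g K) ∘ₗ D).flip

lemma connectionForm_apply (D : CompactSection E F K →ₗ[ℝ] CompactOneForm E F K)
    (ζ η : CompactSection E F K) (x : M) (v : TangentSpace 𝓘(ℝ, E) x) :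
    connectionForm D ζ η x v =
      fiberForm F g K x (D ζ x v) (η x) + fiberForm F g K x (ζ x) (D η x v) :=
  congrArg (fun u : UniversalFormFiber F g K x => fiberForm F g K x (D ζ x v) (η x) + u)
    (universalForm_symm (L := K x) (D η x v) (ζ x))

/-- `d` is the continuous Koszul connection on `V(K)` with `d ∘ κ_K = β`, for the form `β`
obtained from `D`. -/
structure IsInducedConnection (D : CompactSection E F K →ₗ[ℝ] CompactOneForm E F K)
    (d : CompactSection E (UniversalFormModel g) (UniversalFormFiber F g K) →ₗ[ℝ]
      CompactOneForm E (UniversalFormModel g) (UniversalFormFiber F g K)) : Prop where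
  continuous : Continuous d
  koszul : IsKoszulConnection d
  comp_form : ∀ ζ η : CompactSection E F K, d (sectionForm E F g K ζ η) = connectionForm D ζ η

/-- The bilinear map `ω(η, ζ) = [κ̃_K(Dη, ζ)]` with values in `Ω_c^1(M, V(K)) / d C_c^∞(M, V(K))`,
which is regarded as a trivial module of the Lie algebra `C_c^∞(M, K)`. -/
def connectionCocycle (D : CompactSection E F K →ₗ[ℝ] CompactOneForm E F K)
    (d : CompactSection E (UniversalFormModel g) (UniversalFormFiber F g K) →ₗ[ℝ]
      CompactOneForm E (UniversalFormModel g) (UniversalFormFiber F g K)) :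
    CompactSection E F K →ₗ[ℝ] CompactSection E F K →ₗ[ℝ]
      (CompactOneForm E (UniversalFormModel g) (UniversalFormFiber F g K) ⧸ LinearMap.range d) :=
  ((oneFormForm E F g K) ∘ₗ D).compr₂ (LinearMap.range d).mkQ

end LieSections

end

/-! In a Lie trivialization the bracket and `κ` have constant coefficients. There, at a point and
along a tangent vector, a Lie connection `D` is the coordinate derivative plus an endomorphism `δ`
of `g`. The difference of two Koszul connections is tensorial, and since both obey the Leibniz rule
for the bracket, `δ` is a derivation of `g` (`exists_derivation`). It induces an endomorphism of
`V(g)`. The coordinate derivative plus this endomorphism is a linear map `P` carrying `κ_K(s, t)` to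
`β(s, t)` at that point (`exists_linearMap_connectionForm`). So every relation among values of `κ_K`
also holds for `β` (`ker_lift_sectionForm_le`).

Conversely, values of `κ_K` span all sections of `V(K)`. For sections supported in a fixed compact
set there is an expansion `η = ∑ κ_K(φ_k, T_k η)` with fixed `φ_k` and continuous linear `T_k`
(`exists_sum_sectionForm`). Hence `β` descends to a unique linear `d` with `d ∘ κ_K = β`. Its
continuity follows from `d η = ∑ β(φ_k, T_k η)`, and the Koszul rule from `f κ_K(s, t) = κ_K(f s,
t)`.

The cocycle identity holds for `κ̃_K(Dη, ζ)` itself, by invariance of `κ`. The quotient by the image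
of `d` makes the form alternating, because `κ̃_K(Dη, η) = d(κ_K(η, η) / 2)`.

The analytic point is joint continuity of `κ̃_K` (`continuous_oneFormForm`): on an inductive limit,
bounds on each space of sections with fixed compact support do not suffice. With locally finite
functions such that `∑ χ_i f_i² = 1`, write `κ̃_K(α, s) = ∑ χ_i κ̃_K(f_i α, f_i s)`. A seminorm of
the `i`-th term is at most `q_i(f_i α) r_i(f_i s)` by the Leibniz formula in charts. The sums `∑
q_i(f_i α)` and `∑ r_i(f_i s)` are locally finite, hence dominated by continuous seminorms `Q` and
`R` (`exists_seminorm_sum_le`), so the whole is at most `Q(α) R(s)`. -/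

noncomputable section

set_option linter.unusedSectionVars false

/-! ### Seminorms on the space of smooth sections -/

section SectionSeminorms

variable (E : Type*) [NormedAddCommGroup E] [NormedSpace ℝ E]
  {M : Type*} [TopologicalSpace M] [ChartedSpace E M]
  (F : Type*) [NormedAddCommGroup F] [NormedSpace ℝ F]
  (V : M → Type*) [∀ x, AddCommGroup (V x)] [∀ x, Module ℝ (V x)]
  [TopologicalSpace (TotalSpace F V)] [∀ x, TopologicalSpace (V x)]
  [FiberBundle F V] [VectorBundle ℝ F V]

attribute [local instance] smoothSectionTopology

/-- The data of a seminorm on `C^∞(M, V)`: a local trivialization, a chart, an order of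
differentiation and a compact set in the chart domain. -/
structure SectionSeminormIndex where
  /-- the local trivialization -/
  triv : Trivialization F (π F V)
  triv_mem : MemTrivializationAtlas triv
  /-- the chart -/
  chart : OpenPartialHomeomorph M E
  chart_mem : chart ∈ atlas E M
  /-- the order of differentiation -/
  order : ℕ
  /-- the compact set, in the coordinates of the chart -/
  set : Set E
  isCompact : IsCompact set
  subset : set ⊆ chart.target ∩ chart.symm ⁻¹' triv.baseSet

attribute [instance] SectionSeminormIndex.triv_mem

variable {E F V}

lemma isOpen_localRep_domain (e : Trivialization F (π F V)) (φ : OpenPartialHomeomorph M E) :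
    IsOpen (φ.target ∩ φ.symm ⁻¹' e.baseSet) :=
  φ.isOpen_inter_preimage_symm e.open_baseSet

lemma contDiffOn_localRep [IsManifold 𝓘(ℝ, E) ∞ M] [ContMDiffVectorBundle ∞ F V 𝓘(ℝ, E)]
    (e : Trivialization F (π F V)) [MemTrivializationAtlas e]
    {φ : OpenPartialHomeomorph M E} (hφ : φ ∈ atlas E M) (s : SmoothSection E F V) :
    ContDiffOn ℝ ∞ (localRep E e φ s) (φ.target ∩ φ.symm ⁻¹' e.baseSet) := by
  have hs : ContMDiffOn 𝓘(ℝ, E) 𝓘(ℝ, F) ∞ (fun x => (e ⟨x, s x⟩).2) e.baseSet := fun x hx =>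
    ((e.contMDiffAt_section_iff hx).1 (s.contMDiff x)).contMDiffWithinAt
  have hφ' := contMDiffOn_symm_of_mem_maximalAtlas
    (IsManifold.subset_maximalAtlas (I := 𝓘(ℝ, E)) (n := ∞) hφ)
  exact contMDiffOn_iff_contDiffOn.1
    (hs.comp (hφ'.mono inter_subset_left) fun z hz => hz.2)

lemma localRep_add (e : Trivialization F (π F V)) [MemTrivializationAtlas e]
    (φ : OpenPartialHomeomorph M E) (s t : SmoothSection E F V) {z : E}
    (hz : φ.symm z ∈ e.baseSet) :
    localRep E e φ (s + t) z = localRep E e φ s z + localRep E e φ t z :=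
  (e.linear ℝ hz).map_add _ _

lemma localRep_smul (e : Trivialization F (π F V)) [MemTrivializationAtlas e]
    (φ : OpenPartialHomeomorph M E) (c : ℝ) (s : SmoothSection E F V) {z : E}
    (hz : φ.symm z ∈ e.baseSet) :
    localRep E e φ (c • s) z = c • localRep E e φ s z :=
  (e.linear ℝ hz).map_smul _ _

variable [IsManifold 𝓘(ℝ, E) ∞ M] [ContMDiffVectorBundle ∞ F V 𝓘(ℝ, E)]

namespace SectionSeminormIndex

variable (i : SectionSeminormIndex E F V)

instance : CompactSpace i.set := isCompact_iff_compactSpace.1 i.isCompact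

/-- The domain of the local representations. -/
def domain : Set E := i.chart.target ∩ i.chart.symm ⁻¹' i.triv.baseSet

lemma isOpen_domain : IsOpen i.domain := isOpen_localRep_domain _ _

/-- The local representation of a section. -/
def rep (s : SmoothSection E F V) : E → F := localRep E i.triv i.chart s

lemma contDiffOn_rep (s : SmoothSection E F V) : ContDiffOn ℝ ∞ (i.rep s) i.domain :=
  contDiffOn_localRep _ i.chart_mem s

lemma contDiffAt_rep (s : SmoothSection E F V) {z : E} (hz : z ∈ i.domain) :
    ContDiffAt ℝ ∞ (i.rep s) z :=
  (i.contDiffOn_rep s).contDiffAt (i.isOpen_domain.mem_nhds hz)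

/-- The restriction to a compact set of a derivative of the local representation. -/
def derivRestrict : SmoothSection E F V →ₗ[ℝ] C(i.set, E [×i.order]→L[ℝ] F) where
  toFun s := ⟨fun z => iteratedFDeriv ℝ i.order (i.rep s) z, by
    refine (ContinuousOn.mono ?_ i.subset).domRestrict
    have h := (i.contDiffOn_rep s).continuousOn_iteratedFDerivWithin (m := i.order)
      (by exact_mod_cast le_top) i.isOpen_domain.uniqueDiffOn
    exact h.congr fun z hz => (iteratedFDerivWithin_of_isOpen _ i.isOpen_domain hz).symm⟩
  map_add' s t := by
    ext1 z
    have hz := i.subset z.2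
    have h : i.rep (s + t) =ᶠ[𝓝 (z : E)] i.rep s + i.rep t := by
      filter_upwards [i.isOpen_domain.mem_nhds hz] with y hy
      exact localRep_add _ _ s t hy.2
    change iteratedFDeriv ℝ i.order (i.rep (s + t)) z = _
    rw [(h.iteratedFDeriv ℝ _).eq_of_nhds, iteratedFDeriv_add_apply]
    · rfl
    · exact (i.contDiffAt_rep s hz).of_le (by exact_mod_cast le_top)
    · exact (i.contDiffAt_rep t hz).of_le (by exact_mod_cast le_top)
  map_smul' c s := by
    ext1 z
    have hz := i.subset z.2
    have h : i.rep (c • s) =ᶠ[𝓝 (z : E)] c • i.rep s := by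
      filter_upwards [i.isOpen_domain.mem_nhds hz] with y hy
      exact localRep_smul _ _ c s hy.2
    change iteratedFDeriv ℝ i.order (i.rep (c • s)) z = _
    rw [(h.iteratedFDeriv ℝ _).eq_of_nhds, iteratedFDeriv_const_smul_apply]
    · rfl
    · exact (i.contDiffAt_rep s hz).of_le (by exact_mod_cast le_top)

/-- The seminorm `sup ‖D^n s‖` over a compact set, in local coordinates. -/
def seminorm : Seminorm ℝ (SmoothSection E F V) :=
  (normSeminorm ℝ C(i.set, E [×i.order]→L[ℝ] F)).comp i.derivRestrict

lemma norm_iteratedFDeriv_le_seminorm (s : SmoothSection E F V) {z : E} (hz : z ∈ i.set) :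
    ‖iteratedFDeriv ℝ i.order (i.rep s) z‖ ≤ i.seminorm s :=
  (i.derivRestrict s).norm_coe_le_norm ⟨z, hz⟩

lemma seminorm_le (s : SmoothSection E F V) {r : ℝ} (hr : 0 ≤ r)
    (h : ∀ z ∈ i.set, ‖iteratedFDeriv ℝ i.order (i.rep s) z‖ ≤ r) : i.seminorm s ≤ r :=
  ((i.derivRestrict s).norm_le hr).2 fun z => h z z.2

/-- The same seminorm with another order of differentiation. -/
@[simps] def withOrder (k : ℕ) : SectionSeminormIndex E F V where
  triv := i.triv
  triv_mem := i.triv_mem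
  chart := i.chart
  chart_mem := i.chart_mem
  order := k
  set := i.set
  isCompact := i.isCompact
  subset := i.subset

end SectionSeminormIndex

lemma Seminorm.finsetSum_apply {ι X : Type*} [AddCommGroup X] [Module ℝ X]
    (p : ι → Seminorm ℝ X) (S : Finset ι) (x : X) : (∑ i ∈ S, p i) x = ∑ i ∈ S, p i x := by
  change FunLike.coeAddMonoidHom _ _ _ (∑ i ∈ S, p i) x = _
  simp_rw [map_sum, Finset.sum_apply]
  rfl

variable (E F V) in
-- Uniform convergence on a family of sets is the infimum over its members, and on one compact set
-- it is the sup-norm topology of continuous maps. The result is an initial topology for linear maps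
-- into normed spaces, from which seminorms can be read off.
lemma smoothSectionTopology_eq_iInf : smoothSectionTopology E F V =
    ⨅ i : SectionSeminormIndex E F V, TopologicalSpace.induced i.derivRestrict inferInstance := by
  have key : ∀ i : SectionSeminormIndex E F V,
      TopologicalSpace.induced i.derivRestrict inferInstance =
        TopologicalSpace.induced (fun s : SmoothSection E F V =>
          UniformFun.ofFun (i.set.domRestrict (iteratedFDeriv ℝ i.order (i.rep s))))
          (UniformFun.topologicalSpace i.set _) := by
    intro i
    have h := (ContinuousMap.isUniformEmbedding_uniformFunOfFun (α := i.set)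
      (β := E [×i.order]→L[ℝ] F)).isInducing.eq_induced
    exact (congrArg (TopologicalSpace.induced i.derivRestrict) h).trans induced_compose
  simp only [key, smoothSectionTopology, UniformOnFun.topologicalSpace_eq, induced_iInf,
    induced_compose]
  refine le_antisymm (le_iInf fun i => ?_) ?_
  · refine iInf₂_le_of_le i.triv i.triv_mem.out (iInf₂_le_of_le i.chart i.chart_mem
      (iInf_le_of_le i.order (iInf₂_le_of_le i.set ⟨i.isCompact, i.subset⟩ le_rfl)))
  · refine le_iInf₂ fun e he => le_iInf₂ fun φ hφ => le_iInf fun n => le_iInf₂ fun C hC => ?_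
    exact iInf_le_of_le ⟨e, ⟨he⟩, φ, hφ, n, C, hC.1, hC.2⟩ le_rfl

variable (E F V) in
lemma withSeminorms_smoothSection :
    WithSeminorms (SectionSeminormIndex.seminorm : SectionSeminormIndex E F V → _) := by
  have hn : ∀ i : SectionSeminormIndex E F V, @WithSeminorms ℝ C(i.set, E [×i.order]→L[ℝ] F)
      (Fin 1) _ _ _ (fun _ => normSeminorm ℝ C(i.set, E [×i.order]→L[ℝ] F))
      ContinuousMap.compactOpen := fun i => norm_withSeminorms ℝ _
  have h := withSeminorms_iInf (𝕜 := ℝ) (E := SmoothSection E F V)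
    (t := fun i : SectionSeminormIndex E F V =>
      TopologicalSpace.induced i.derivRestrict inferInstance)
    (p := fun i => SeminormFamily.comp (fun _ : Fin 1 =>
      normSeminorm ℝ C(i.set, E [×i.order]→L[ℝ] F)) i.derivRestrict) fun i =>
      LinearMap.withSeminorms_induced (hn i) i.derivRestrict
  rw [← smoothSectionTopology_eq_iInf] at h
  exact h.congr_equiv (Equiv.sigmaUnique (SectionSeminormIndex E F V) fun _ => Fin 1).symm

instance : IsTopologicalAddGroup (SmoothSection E F V) :=
  (withSeminorms_smoothSection E F V).topologicalAddGroup

instance : ContinuousSMul ℝ (SmoothSection E F V) :=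
  (withSeminorms_smoothSection E F V).continuousSMul

lemma SectionSeminormIndex.continuous_seminorm (i : SectionSeminormIndex E F V) :
    Continuous i.seminorm :=
  (withSeminorms_smoothSection E F V).continuous_seminorm i

/-- A sum replaces the usual finite supremum because sums of products are bounded termwise by
products of sums. -/
lemma exists_le_sum_sectionSeminorm {q : Seminorm ℝ (SmoothSection E F V)} (hq : Continuous q) :
    ∃ (S : Finset (SectionSeminormIndex E F V)) (c : ℝ), 0 ≤ c ∧
      ∀ s, q s ≤ c * ∑ i ∈ S, i.seminorm s := by
  obtain ⟨S, c, -, h⟩ := Seminorm.bound_of_continuous (withSeminorms_smoothSection E F V) q hq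
  refine ⟨S, c, c.2, fun s => (h s).trans ?_⟩
  have h' := Seminorm.finset_sup_le_sum
    (SectionSeminormIndex.seminorm (E := E) (F := F) (V := V)) S s
  rw [Seminorm.finsetSum_apply] at h'
  exact mul_le_mul_of_nonneg_left h' c.2

namespace CompactSection

variable (E F V) in
/-- The inclusion of `C_c^∞(M, V)` in `C^∞(M, V)`. -/
def toSmooth : CompactSection E F V →ₗ[ℝ] SmoothSection E F V :=
  (compactSectionSubmodule E F V).subtype

lemma continuous_ofSupportedIn (C : TopologicalSpace.Compacts M) :
    Continuous (ofSupportedIn : SupportedIn E F V C → CompactSection E F V) :=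
  continuous_sInf_rng.2 fun _ ht => ht.1 C

/-- A seminorm on `C_c^∞(M, V)` is continuous if on sections supported in a fixed compact set it is
bounded by a continuous seminorm of `C^∞(M, V)`. -/
lemma continuous_seminorm_of_le [T2Space M] (q : Seminorm ℝ (CompactSection E F V))
    (h : ∀ C : TopologicalSpace.Compacts M, ∃ q' : Seminorm ℝ (SmoothSection E F V),
      Continuous q' ∧ ∀ s : CompactSection E F V, sectionSupport s ⊆ C →
        q s ≤ q' (toSmooth E F V s)) : Continuous q := by
  -- The topology given by `q` alone is locally convex. Once the inclusions are continuous for it,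
  -- it belongs to the family whose infimum is the inductive limit topology, so the latter is finer
  -- and `q` is continuous for it.
  set t : TopologicalSpace (CompactSection E F V) :=
    q.toSeminormedAddCommGroup.toUniformSpace.toTopologicalSpace with ht
  have hg : @IsTopologicalAddGroup _ t _ :=
    @SeminormedAddCommGroup.toIsTopologicalAddGroup _ q.toSeminormedAddCommGroup
  have hw : @WithSeminorms ℝ (CompactSection E F V) Unit _ _ _ (fun _ => q) t :=
    (@SeminormFamily.withSeminorms_iff_topologicalSpace_eq_iInf ℝ _ Unit _ _ _ t hg
      fun _ => q).2 (by rw [iInf_unique])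
  have hq : Continuous[t, inferInstance] q := hw.continuous_seminorm ()
  refine continuous_le_dom (sInf_le ⟨fun C => ?_, hg, hw.continuousSMul,
    hw.toLocallyConvexSpace⟩) hq
  obtain ⟨q', hq', hle⟩ := h C
  rw [continuous_iff_continuousAt]
  intro s₀
  refine (hw.tendsto_nhds _ _).2 fun _ ε hε => ?_
  have hc : Continuous fun s : SupportedIn E F V C => q' (s.1 - s₀.1) :=
    hq'.comp ((continuous_induced_dom (f := Subtype.val)).sub continuous_const)
  have h0 : q' (s₀.1 - s₀.1) < ε := by rw [sub_self, map_zero]; exact hε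
  filter_upwards [hc.continuousAt.eventually_lt continuousAt_const h0] with s hs
  refine lt_of_le_of_lt (hle _ ?_) hs
  -- The bound is applied to the difference of two sections supported in `C`, which is again
  -- supported in `C`.
  refine closure_minimal (fun x hx => ?_) C.isCompact.isClosed
  by_contra hxC
  have h1 : s.1 x = 0 := by_contra fun h => hxC (s.2 (subset_closure h))
  have h2 : s₀.1 x = 0 := by_contra fun h => hxC (s₀.2 (subset_closure h))
  apply hx
  change s.1 x - s₀.1 x = 0
  rw [h1, h2, sub_zero]

end CompactSection

end SectionSeminorms

/-! ### Continuity of operators of order zero -/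

section SectionOperators

attribute [local instance] smoothSectionTopology

variable {E : Type*} [NormedAddCommGroup E] [NormedSpace ℝ E]
  {M : Type*} [TopologicalSpace M] [ChartedSpace E M] [IsManifold 𝓘(ℝ, E) ∞ M]
  {F : Type*} [NormedAddCommGroup F] [NormedSpace ℝ F]
  {V : M → Type*} [∀ x, AddCommGroup (V x)] [∀ x, Module ℝ (V x)]
  [TopologicalSpace (TotalSpace F V)] [∀ x, TopologicalSpace (V x)]
  [FiberBundle F V] [VectorBundle ℝ F V] [ContMDiffVectorBundle ∞ F V 𝓘(ℝ, E)]
  {G : Type*} [NormedAddCommGroup G] [NormedSpace ℝ G]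
  {W : M → Type*} [∀ x, AddCommGroup (W x)] [∀ x, Module ℝ (W x)]
  [TopologicalSpace (TotalSpace G W)] [∀ x, TopologicalSpace (W x)]
  [FiberBundle G W] [VectorBundle ℝ G W] [ContMDiffVectorBundle ∞ G W 𝓘(ℝ, E)]
  {H : Type*} [NormedAddCommGroup H] [NormedSpace ℝ H]
  {Y : M → Type*} [∀ x, AddCommGroup (Y x)] [∀ x, Module ℝ (Y x)]
  [TopologicalSpace (TotalSpace H Y)] [∀ x, TopologicalSpace (Y x)]
  [FiberBundle H Y] [VectorBundle ℝ H Y] [ContMDiffVectorBundle ∞ H Y 𝓘(ℝ, E)]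

namespace CompactSection

/-- A linear map on `C_c^∞(M, V)` to a locally convex space is continuous if it is so on sections
supported in a fixed compact set. -/
lemma continuous_of_seminorm_le [T2Space M] {X : Type*} [AddCommGroup X] [Module ℝ X]
    [TopologicalSpace X] [IsTopologicalAddGroup X] [ContinuousSMul ℝ X] [LocallyConvexSpace ℝ X]
    (T : CompactSection E F V →ₗ[ℝ] X)
    (h : ∀ p : Seminorm ℝ X, Continuous p → ∀ C : TopologicalSpace.Compacts M,
      ∃ q' : Seminorm ℝ (SmoothSection E F V), Continuous q' ∧
        ∀ s : CompactSection E F V, sectionSupport s ⊆ C → p (T s) ≤ q' (toSmooth E F V s)) :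
    Continuous T := by
  have hX : WithSeminorms (gaugeSeminormFamily ℝ X) := with_gaugeSeminormFamily
  refine hX.continuous_of_continuous_comp T fun i => ?_
  exact continuous_seminorm_of_le _ (h _ (hX.continuous_seminorm i))

/-- A linear map from `C^∞(M, V)` to sections of `W` supported in a fixed compact set is
continuous as soon as the seminorms of `C^∞(M, W)` are bounded. -/
lemma continuous_of_support_subset (T : SmoothSection E F V →ₗ[ℝ] CompactSection E G W)
    (C : TopologicalSpace.Compacts M) (hC : ∀ s, sectionSupport (T s) ⊆ C)
    (h : ∀ i : SectionSeminormIndex E G W, ∃ q : Seminorm ℝ (SmoothSection E F V),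
      Continuous q ∧ ∀ s, i.seminorm (toSmooth E G W (T s)) ≤ q s) : Continuous T := by
  have h1 : Continuous (toSmooth E G W ∘ₗ T) := by
    refine (withSeminorms_smoothSection E G W).continuous_of_continuous_comp _ fun i => ?_
    obtain ⟨q, hq, hle⟩ := h i
    exact Seminorm.continuous_of_le hq hle
  have h2 : Continuous fun s => (⟨(T s).1, hC s⟩ : SupportedIn E G W C) :=
    continuous_induced_rng.2 h1
  exact (continuous_ofSupportedIn C).comp h2

end CompactSection

namespace SectionSeminormIndex

/-- Operators given by a smooth matrix in local coordinates are bounded. -/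
lemma exists_seminorm_le (i : SectionSeminormIndex E G W) (j : SectionSeminormIndex E F V)
    (T : SmoothSection E F V → SmoothSection E G W) {B : E → F →L[ℝ] G} {U : Set E}
    (hU : IsOpen U) (hjU : j.set ⊆ U) (hUj : U ⊆ j.domain) (hB : ContDiffOn ℝ ∞ B U)
    (hT : ∀ s, ∀ z ∈ U, i.rep (T s) z = B z (j.rep s z))
    (h0 : ∀ s, ∀ z ∈ i.set, z ∉ j.set → i.rep (T s) =ᶠ[𝓝 z] 0) :
    ∃ q : Seminorm ℝ (SmoothSection E F V), Continuous q ∧ ∀ s, i.seminorm (T s) ≤ q s := by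
  -- The Leibniz formula for `B z (j.rep s z)` needs the derivatives of the matrix `B` only on the
  -- compact set `j.set`. The weights `a k` below are its coefficients; `|c k|` guards against a
  -- negative bound, possible when `j.set` is empty.
  have hbound : ∀ k : ℕ, ∃ c : ℝ, ∀ z ∈ j.set, ‖iteratedFDerivWithin ℝ k B U z‖ ≤ c := fun k =>
    j.isCompact.exists_bound_of_continuousOn ((hB.continuousOn_iteratedFDerivWithin (m := k)
      (by exact_mod_cast le_top) hU.uniqueDiffOn).mono hjU)
  choose c hc using hbound
  set n := i.order with hn
  set b := ContinuousLinearMap.id ℝ (F →L[ℝ] G) with hb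
  let a : ℕ → NNReal := fun k =>
    ⟨‖b‖ * ((n.choose k : ℝ) * |c k|), by positivity⟩
  set q : Seminorm ℝ (SmoothSection E F V) :=
    ∑ k ∈ Finset.range (n + 1), a k • (j.withOrder (n - k)).seminorm with hq
  have hqs : ∀ s, q s = ∑ k ∈ Finset.range (n + 1), ‖b‖ * ((n.choose k : ℝ) * |c k|) *
      (j.withOrder (n - k)).seminorm s := by
    intro s
    rw [hq, Seminorm.finsetSum_apply]
    rfl
  refine ⟨q, Seminorm.continuous_finsetSum fun k _ => ?_, fun s => i.seminorm_le _
    (apply_nonneg _ _) fun z hz => ?_⟩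
  · exact (continuous_seminorm _).const_smul (a k)
  by_cases hzj : z ∈ j.set
  · have hzU := hjU hzj
    have heq : i.rep (T s) =ᶠ[𝓝 z] fun z => b (B z) (j.rep s z) := by
      filter_upwards [hU.mem_nhds hzU] with y hy using hT s y hy
    rw [(heq.iteratedFDeriv ℝ _).eq_of_nhds, ← iteratedFDerivWithin_of_isOpen _ hU hzU]
    refine (b.norm_iteratedFDerivWithin_le_of_bilinear hB ((j.contDiffOn_rep s).mono hUj)
      hU.uniqueDiffOn hzU (by exact_mod_cast le_top)).trans ?_
    rw [hqs, Finset.mul_sum]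
    refine Finset.sum_le_sum fun k _ => ?_
    rw [mul_assoc ‖b‖]
    refine mul_le_mul_of_nonneg_left ?_ (norm_nonneg _)
    refine mul_le_mul (mul_le_mul_of_nonneg_left ((hc k z hzj).trans (le_abs_self _))
      (Nat.cast_nonneg _)) ?_ (norm_nonneg _) (by positivity)
    rw [iteratedFDerivWithin_of_isOpen _ hU hzU]
    exact (j.withOrder (n - k)).norm_iteratedFDeriv_le_seminorm s hzj
  -- Outside `j.set` the image vanishes near `z`, so all its derivatives there are zero.
  · rw [((h0 s z hz hzj).iteratedFDeriv ℝ _).eq_of_nhds]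
    have : iteratedFDeriv ℝ i.order (0 : E → G) = 0 := iteratedFDeriv_fun_zero
    rw [this]
    simp

/-- Expressions that are bilinear in local coordinates are bounded. -/
lemma exists_seminorm_le_mul (i : SectionSeminormIndex E H Y) (j : SectionSeminormIndex E F V)
    (k : SectionSeminormIndex E G W) (b : F →L[ℝ] G →L[ℝ] H) {U : Set E} (hU : IsOpen U)
    (hiU : i.set ⊆ U) (hij : i.set ⊆ j.set) (hik : i.set ⊆ k.set)
    (hUj : U ⊆ j.domain) (hUk : U ⊆ k.domain) :
    ∃ (q : Seminorm ℝ (SmoothSection E F V)) (r : Seminorm ℝ (SmoothSection E G W)),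
      Continuous q ∧ Continuous r ∧ ∀ (u : SmoothSection E H Y) (s : SmoothSection E F V)
        (t : SmoothSection E G W), (∀ z ∈ U, i.rep u z = b (j.rep s z) (k.rep t z)) →
          i.seminorm u ≤ q s * r t := by
  set n := i.order with hn
  have hb : 0 ≤ ‖b‖ := b.opNorm_nonneg
  -- The Leibniz formula gives a sum of products of seminorms of orders `l` and `n - l`. Taking in
  -- `q` and in `r` the sum over all orders up to `n` bounds each term by the same product, so only
  -- the binomial coefficients remain to be summed.
  let a : NNReal := ⟨‖b‖ * ∑ l ∈ Finset.range (n + 1), (n.choose l : ℝ), by positivity⟩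
  set q : Seminorm ℝ (SmoothSection E F V) :=
    ∑ l ∈ Finset.range (n + 1), (j.withOrder l).seminorm with hq
  set r : Seminorm ℝ (SmoothSection E G W) :=
    ∑ l ∈ Finset.range (n + 1), (k.withOrder l).seminorm with hr
  have hq' : ∀ s, ∀ l ∈ Finset.range (n + 1), (j.withOrder l).seminorm s ≤ q s := by
    intro s l hl
    rw [hq, Seminorm.finsetSum_apply]
    exact Finset.single_le_sum (f := fun l => (j.withOrder l).seminorm s)
      (fun _ _ => apply_nonneg _ _) hl
  have hr' : ∀ s, ∀ l ∈ Finset.range (n + 1), (k.withOrder l).seminorm s ≤ r s := by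
    intro s l hl
    rw [hr, Seminorm.finsetSum_apply]
    exact Finset.single_le_sum (f := fun l => (k.withOrder l).seminorm s)
      (fun _ _ => apply_nonneg _ _) hl
  refine ⟨a • q, r, (Seminorm.continuous_finsetSum fun l _ => continuous_seminorm _).const_smul a,
    Seminorm.continuous_finsetSum fun l _ => continuous_seminorm _, fun u s t h => ?_⟩
  have haq : (a • q) s = ‖b‖ * (∑ l ∈ Finset.range (n + 1), (n.choose l : ℝ)) * q s := rfl
  refine i.seminorm_le _ (by positivity) fun z hz => ?_
  have hzU := hiU hz
  have heq : i.rep u =ᶠ[𝓝 z] fun z => b (j.rep s z) (k.rep t z) := by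
    filter_upwards [hU.mem_nhds hzU] with y hy using h y hy
  rw [(heq.iteratedFDeriv ℝ _).eq_of_nhds, ← iteratedFDerivWithin_of_isOpen _ hU hzU]
  refine (b.norm_iteratedFDerivWithin_le_of_bilinear ((j.contDiffOn_rep s).mono hUj)
    ((k.contDiffOn_rep t).mono hUk) hU.uniqueDiffOn hzU (by exact_mod_cast le_top)).trans ?_
  rw [haq, mul_assoc, mul_assoc, Finset.sum_mul]
  refine mul_le_mul_of_nonneg_left (Finset.sum_le_sum fun l hl => ?_) hb
  rw [mul_assoc]
  refine mul_le_mul_of_nonneg_left ?_ (Nat.cast_nonneg _)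
  rw [iteratedFDerivWithin_of_isOpen _ hU hzU, iteratedFDerivWithin_of_isOpen _ hU hzU]
  refine mul_le_mul ?_ ?_ (norm_nonneg _) (apply_nonneg _ _)
  · exact ((j.withOrder l).norm_iteratedFDeriv_le_seminorm s (hij hz)).trans (hq' s l hl)
  · refine ((k.withOrder (n - l)).norm_iteratedFDeriv_le_seminorm t (hik hz)).trans
      (hr' t _ ?_)
    rw [Finset.mem_range]
    omega

end SectionSeminormIndex

end SectionOperators

/-! ### Cut-off and change of bundle -/

section LocalOperators

attribute [local instance] smoothSectionTopology

variable {E : Type*} [NormedAddCommGroup E] [NormedSpace ℝ E]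
  {M : Type*} [TopologicalSpace M] [ChartedSpace E M] [IsManifold 𝓘(ℝ, E) ∞ M]
  {F : Type*} [NormedAddCommGroup F] [NormedSpace ℝ F]
  {V : M → Type*} [∀ x, AddCommGroup (V x)] [∀ x, Module ℝ (V x)]
  [TopologicalSpace (TotalSpace F V)] [∀ x, TopologicalSpace (V x)]
  [FiberBundle F V] [VectorBundle ℝ F V] [ContMDiffVectorBundle ∞ F V 𝓘(ℝ, E)]
  {G : Type*} [NormedAddCommGroup G] [NormedSpace ℝ G]
  {W : M → Type*} [∀ x, AddCommGroup (W x)] [∀ x, Module ℝ (W x)]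
  [TopologicalSpace (TotalSpace G W)] [∀ x, TopologicalSpace (W x)]
  [FiberBundle G W] [VectorBundle ℝ G W] [ContMDiffVectorBundle ∞ G W 𝓘(ℝ, E)]

namespace CompactSection

lemma sectionSupport_smul_subset (f : M → ℝ) (s : ∀ x, V x) :
    sectionSupport (fun x => f x • s x) ⊆ tsupport f :=
  closure_mono fun x hx hf => hx (by
    simp only [hf, zero_smul])

lemma isCompact_sectionSupport_smul {f : M → ℝ} (hf : HasCompactSupport f) (s : ∀ x, V x) :
    IsCompact (sectionSupport (fun x => f x • s x)) :=
  hf.isCompact.of_isClosed_subset isClosed_closure (sectionSupport_smul_subset f s)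

/-- Multiplication of smooth sections by a compactly supported smooth function. -/
def cutoff (f : C^∞⟮𝓘(ℝ, E), M; 𝓘(ℝ), ℝ⟯) (hf : HasCompactSupport f) :
    SmoothSection E F V →ₗ[ℝ] CompactSection E F V where
  toFun s := mk (fun x => f x • s x) (f.contMDiff.smul_section s.contMDiff)
    (isCompact_sectionSupport_smul hf s)
  map_add' _ _ := ext fun _ => smul_add _ _ _
  map_smul' _ _ := ext fun _ => smul_comm _ _ _

/-- All values are supported in the one compact set `tsupport f`, and locally the operator is the
scalar matrix `f`. This makes seminorms of `C_c^∞` usable on `C^∞` after a cut-off. -/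
lemma continuous_cutoff [T2Space M] (f : C^∞⟮𝓘(ℝ, E), M; 𝓘(ℝ), ℝ⟯) (hf : HasCompactSupport f) :
    Continuous (cutoff f hf : SmoothSection E F V →ₗ[ℝ] CompactSection E F V) := by
  refine continuous_of_support_subset _ ⟨tsupport f, hf⟩
    (fun s => sectionSupport_smul_subset f s) fun i => ?_
  have hf' : ContDiffOn ℝ ∞ (fun z => f (i.chart.symm z)) i.domain :=
    contMDiffOn_iff_contDiffOn.1 (f.contMDiff.comp_contMDiffOn
      ((contMDiffOn_symm_of_mem_maximalAtlas (IsManifold.subset_maximalAtlas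
        (I := 𝓘(ℝ, E)) (n := ∞) i.chart_mem)).mono inter_subset_left))
  refine i.exists_seminorm_le i (fun s => toSmooth E F V (cutoff f hf s))
    (B := fun z => f (i.chart.symm z) • ContinuousLinearMap.id ℝ F) i.isOpen_domain i.subset
    subset_rfl (hf'.smul contDiffOn_const) (fun s z hz => ?_) fun s z hz hz' => (hz' hz).elim
  exact (i.triv.linear ℝ hz.2).map_smul _ _

/-- The section `h • u`, where `u` is given in a local trivialization and the support of `h` is
contained in its domain. -/
def ofLocal (e : Trivialization F (π F V)) [MemTrivializationAtlas e]
    (h : C^∞⟮𝓘(ℝ, E), M; 𝓘(ℝ), ℝ⟯) (hc : HasCompactSupport h) {U : Set M} (hU : IsOpen U)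
    (hhU : tsupport h ⊆ U) (hUe : U ⊆ e.baseSet) (u : M → F)
    (hu : ContMDiffOn 𝓘(ℝ, E) 𝓘(ℝ, F) ∞ u U) : CompactSection E F V :=
  mk (fun x => h x • e.symmₗ ℝ x (u x)) (by
    intro x
    -- On `U` smoothness is read in the trivialization `e`; off `U` the point lies outside `tsupport
    -- h`, so the section is zero nearby.
    by_cases hx : x ∈ U
    · rw [e.contMDiffAt_section_iff (hUe hx)]
      refine (h.contMDiff.contMDiffAt.smul (hu.contMDiffAt (hU.mem_nhds hx))).congr_of_eventuallyEq
        ?_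
      filter_upwards [hU.mem_nhds hx] with y hy
      have h1 : (e ⟨y, e.symmₗ ℝ y (u y)⟩).2 = u y := by
        rw [← congrFun (e.coe_linearMapAt_of_mem (R := ℝ) (hUe hy)) (e.symmₗ ℝ y (u y)),
          e.linearMapAt_symmₗ (hUe hy)]
      exact ((e.linear ℝ (hUe hy)).map_smul _ _).trans (congrArg (h y • ·) h1)
    · refine (contMDiff_zeroSection ℝ V x).congr_of_eventuallyEq ?_
      have : x ∉ tsupport h := fun h' => hx (hhU h')
      filter_upwards [(isClosed_tsupport h).isOpen_compl.mem_nhds this] with y hy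
      rw [image_eq_zero_of_notMem_tsupport hy, zero_smul]
      rfl) (isCompact_sectionSupport_smul hc _)

@[simp] lemma ofLocal_apply (e : Trivialization F (π F V)) [MemTrivializationAtlas e]
    (h : C^∞⟮𝓘(ℝ, E), M; 𝓘(ℝ), ℝ⟯) (hc : HasCompactSupport h) {U : Set M} (hU : IsOpen U)
    (hhU : tsupport h ⊆ U) (hUe : U ⊆ e.baseSet) (u : M → F)
    (hu : ContMDiffOn 𝓘(ℝ, E) 𝓘(ℝ, F) ∞ u U) (x : M) :
    ofLocal e h hc hU hhU hUe u hu x = h x • e.symmₗ ℝ x (u x) := rfl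

lemma contMDiffOn_triv (e : Trivialization F (π F V)) [MemTrivializationAtlas e]
    (s : SmoothSection E F V) :
    ContMDiffOn 𝓘(ℝ, E) 𝓘(ℝ, F) ∞ (fun x => (e ⟨x, s x⟩).2) e.baseSet := fun x hx =>
  ((e.contMDiffAt_section_iff hx).1 (s.contMDiff x)).contMDiffWithinAt

/-- The operator `s ↦ h • A s`, for a linear map `A` between the model fibers, in local
trivializations. -/
def transfer (e : Trivialization F (π F V)) [MemTrivializationAtlas e]
    (e' : Trivialization G (π G W)) [MemTrivializationAtlas e'] (A : F →L[ℝ] G)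
    (h : C^∞⟮𝓘(ℝ, E), M; 𝓘(ℝ), ℝ⟯) (hc : HasCompactSupport h)
    (he : tsupport h ⊆ e.baseSet ∩ e'.baseSet) :
    SmoothSection E F V →ₗ[ℝ] CompactSection E G W where
  toFun s := ofLocal e' h hc (e.open_baseSet.inter e'.open_baseSet) he inter_subset_right
    (fun x => A (e ⟨x, s x⟩).2)
    (A.contMDiff.comp_contMDiffOn ((contMDiffOn_triv e s).mono inter_subset_left))
  map_add' s t := ext fun x => by
    by_cases hx : x ∈ tsupport h
    · have : (e ⟨x, (s + t) x⟩).2 = (e ⟨x, s x⟩).2 + (e ⟨x, t x⟩).2 :=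
        (e.linear ℝ (he hx).1).map_add _ _
      rw [ofLocal_apply, this, map_add, map_add, smul_add]
      rfl
    · simp [image_eq_zero_of_notMem_tsupport hx]
  map_smul' c s := ext fun x => by
    by_cases hx : x ∈ tsupport h
    · have : (e ⟨x, (c • s) x⟩).2 = c • (e ⟨x, s x⟩).2 :=
        (e.linear ℝ (he hx).1).map_smul _ _
      rw [ofLocal_apply, this, map_smul, map_smul, smul_comm]
      rfl
    · simp [image_eq_zero_of_notMem_tsupport hx]

/-- In a chart and a trivialization of the target the operator is the smooth matrix `h` times the
coordinate change composed with `A`. -/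
lemma continuous_transfer [T2Space M] (e : Trivialization F (π F V)) [MemTrivializationAtlas e]
    (e' : Trivialization G (π G W)) [MemTrivializationAtlas e'] (A : F →L[ℝ] G)
    (h : C^∞⟮𝓘(ℝ, E), M; 𝓘(ℝ), ℝ⟯) (hc : HasCompactSupport h)
    (he : tsupport h ⊆ e.baseSet ∩ e'.baseSet) :
    Continuous (transfer e e' A h hc he) := by
  refine continuous_of_support_subset _ ⟨tsupport h, hc⟩
    (fun s => sectionSupport_smul_subset h _) fun i => ?_
  have hcont : ContinuousOn i.chart.symm i.set :=
    i.chart.continuousOn_symm.mono fun z hz => (i.subset hz).1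
  -- The compact set of `i` need not lie over the base set of `e`, so it is cut down to the preimage
  -- of `tsupport h`. On the rest of `i.set` the image vanishes locally.
  let j : SectionSeminormIndex E F V :=
    { triv := e
      triv_mem := inferInstance
      chart := i.chart
      chart_mem := i.chart_mem
      order := i.order
      set := i.set ∩ i.chart.symm ⁻¹' tsupport h
      isCompact := i.isCompact.of_isClosed_subset (hcont.preimage_isClosed_of_isClosed
        i.isCompact.isClosed (isClosed_tsupport h)) inter_subset_left
      subset := fun z hz => ⟨(i.subset hz.1).1, (he hz.2).1⟩ }
  set U := i.chart.target ∩ i.chart.symm ⁻¹' ((e.baseSet ∩ e'.baseSet) ∩ i.triv.baseSet) with hU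
  have hUo : IsOpen U := i.chart.isOpen_inter_preimage_symm
    ((e.open_baseSet.inter e'.open_baseSet).inter i.triv.open_baseSet)
  have hφ := contMDiffOn_symm_of_mem_maximalAtlas
    (IsManifold.subset_maximalAtlas (I := 𝓘(ℝ, E)) (n := ∞) i.chart_mem)
  have h1 : ContDiffOn ℝ ∞ (fun z => h (i.chart.symm z)) U :=
    contMDiffOn_iff_contDiffOn.1 (h.contMDiff.comp_contMDiffOn (hφ.mono inter_subset_left))
  have h2 : ContDiffOn ℝ ∞ (fun z => (e'.coordChangeL ℝ i.triv (i.chart.symm z) : G →L[ℝ] G)) U :=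
    contMDiffOn_iff_contDiffOn.1 ((contMDiffOn_coordChangeL (n := ∞) (IB := 𝓘(ℝ, E))
      e' i.triv).comp (hφ.mono inter_subset_left) fun z hz => ⟨hz.2.1.2, hz.2.2⟩)
  refine i.exists_seminorm_le j (fun s => toSmooth E G W (transfer e e' A h hc he s))
    (B := fun z => h (i.chart.symm z) •
      ((e'.coordChangeL ℝ i.triv (i.chart.symm z) : G →L[ℝ] G).comp A)) hUo
    (fun z hz => ⟨(i.subset hz.1).1, he hz.2, (i.subset hz.1).2⟩)
    (fun z hz => ⟨hz.1, hz.2.1.1⟩) (h1.smul (h2.clm_comp contDiffOn_const)) ?_ ?_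
  · intro s z hz
    have hz' : i.chart.symm z ∈ e'.baseSet ∩ i.triv.baseSet := ⟨hz.2.1.2, hz.2.2⟩
    refine ((i.triv.linear ℝ hz.2.2).map_smul _ _).trans ?_
    refine congrArg (h (i.chart.symm z) • ·) ?_
    change _ = e'.coordChangeL ℝ i.triv (i.chart.symm z) (A (j.rep s z))
    rw [e'.coordChangeL_apply i.triv hz', e'.symmₗ_apply hz'.1]
    rfl
  · intro s z hz hzj
    have hz' : i.chart.symm z ∉ tsupport h := fun h' => hzj ⟨hz, h'⟩
    have hc := (i.chart.continuousAt_symm (i.subset hz).1).preimage_mem_nhds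
      ((isClosed_tsupport h).isOpen_compl.mem_nhds hz')
    filter_upwards [hc, i.isOpen_domain.mem_nhds (i.subset hz)] with y hy hyd
    refine ((i.triv.linear ℝ hyd.2).map_smul _ _).trans ?_
    rw [image_eq_zero_of_notMem_tsupport hy, zero_smul]
    rfl

end CompactSection

end LocalOperators

/-! ### Joint continuity of bilinear maps on compactly supported sections -/

/-- A bilinear map is jointly continuous if the seminorms of its values are bounded by products of
continuous seminorms. -/
lemma LinearMap.continuous₂_of_seminorm_le_mul {X Y Z κ : Type*}
    [AddCommGroup X] [Module ℝ X] [TopologicalSpace X] [IsTopologicalAddGroup X]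
    [AddCommGroup Y] [Module ℝ Y] [TopologicalSpace Y] [IsTopologicalAddGroup Y]
    [AddCommGroup Z] [Module ℝ Z] [TopologicalSpace Z]
    {p : SeminormFamily ℝ Z κ} (hp : WithSeminorms p) (B : X →ₗ[ℝ] Y →ₗ[ℝ] Z)
    (h : ∀ i, ∃ (q : Seminorm ℝ X) (r : Seminorm ℝ Y), Continuous q ∧ Continuous r ∧
      ∀ x y, p i (B x y) ≤ q x * r y) :
    Continuous fun z : X × Y => B z.1 z.2 := by
  rw [continuous_iff_continuousAt]
  rintro ⟨x₀, y₀⟩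
  refine (hp.tendsto_nhds _ _).2 fun i ε hε => ?_
  obtain ⟨q, r, hq, hr, hle⟩ := h i
  -- This continuous majorant of `p i (B z.1 z.2 - B x₀ y₀)` vanishes at `(x₀, y₀)`.
  have hc : Continuous fun z : X × Y => q (z.1 - x₀) * r z.2 + q x₀ * r (z.2 - y₀) :=
    ((hq.comp (continuous_fst.sub continuous_const)).mul (hr.comp continuous_snd)).add
      (continuous_const.mul (hr.comp (continuous_snd.sub continuous_const)))
  have h0 : q (x₀ - x₀) * r y₀ + q x₀ * r (y₀ - y₀) < ε := by simpa using hε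
  filter_upwards [hc.continuousAt.eventually_lt continuousAt_const h0] with z hz
  refine lt_of_le_of_lt ?_ hz
  have : B z.1 z.2 - B x₀ y₀ = B (z.1 - x₀) z.2 + B x₀ (z.2 - y₀) := by
    simp
  rw [this]
  exact (map_add_le_add _ _ _).trans (add_le_add (hle _ _) (hle _ _))

/-! ### Partitions of unity of the form `∑ χ_i f_i² = 1` -/

section QuadraticPartition

variable {E : Type*} [NormedAddCommGroup E] [NormedSpace ℝ E]
  {M : Type*} [TopologicalSpace M] [ChartedSpace E M]

/-- A locally finite family of compactly supported smooth functions `f i`, each supported in some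
`U x`, together with smooth functions `χ i` such that `∑ χ i * f i * f i = 1`. -/
structure QuadraticPartition.{u, v} (E : Type v) [NormedAddCommGroup E] [NormedSpace ℝ E]
    {M : Type u} [TopologicalSpace M] [ChartedSpace E M] (U : M → Set M) where
  /-- the index type -/
  ι : Type u
  /-- the points whose neighborhoods contain the supports -/
  center : ι → M
  /-- the functions of the family -/
  f : ι → C^∞⟮𝓘(ℝ, E), M; 𝓘(ℝ), ℝ⟯
  /-- the weights -/
  χ : ι → C^∞⟮𝓘(ℝ, E), M; 𝓘(ℝ), ℝ⟯
  hasCompactSupport : ∀ i, HasCompactSupport (f i)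
  tsupport_subset : ∀ i, tsupport (f i) ⊆ U (center i)
  tsupport_χ_subset : ∀ i, tsupport (χ i) ⊆ tsupport (f i)
  locallyFinite : LocallyFinite fun i => Function.support (f i)
  sum_eq_one : ∀ x, ∑ᶠ i, χ i x * f i x * f i x = 1

/-- Quadratic partitions of unity exist. -/
lemma exists_quadraticPartition [FiniteDimensional ℝ E] [IsManifold 𝓘(ℝ, E) ∞ M]
    [T2Space M] [SigmaCompactSpace M] (U : M → Set M) (hU : ∀ x, U x ∈ 𝓝 x) :
    Nonempty (QuadraticPartition E U) := by
  obtain ⟨ι, b, hb⟩ := SmoothBumpCovering.exists_isSubordinate 𝓘(ℝ, E) (s := univ) isClosed_univ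
    fun x _ => hU x
  -- With bump functions `b i`, take `f i = b i` and `χ i = b i / ∑ b^3`. Of the three factors `b
  -- i`, two cut off the arguments of a bilinear map, and the third keeps the support of the weight
  -- inside that of `f i`.
  have hcube : ContMDiff 𝓘(ℝ, E) 𝓘(ℝ) ∞ fun x => ∑ᶠ i, (b i x) ^ 3 := by
    refine contMDiff_finsum (fun i => (b i).contMDiff.pow 3)
      (b.locallyFinite.subset fun i x hx => ?_)
    exact fun h => hx (by simp only [h]; norm_num)
  have hpos : ∀ x, 0 < ∑ᶠ i, (b i x) ^ 3 := by
    intro x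
    refine finsum_pos (fun i => pow_nonneg (b i).nonneg 3) ⟨b.ind x (mem_univ x), ?_⟩
      ((b.point_finite x).subset fun i hi h => hi ?_)
    · rw [b.apply_ind x (mem_univ x)]; norm_num
    · simp only [h]; norm_num
  have hχ : ∀ i, ContMDiff 𝓘(ℝ, E) 𝓘(ℝ) ∞ fun x => b i x * (∑ᶠ i, (b i x) ^ 3)⁻¹ := fun i =>
    (b i).contMDiff.mul (hcube.inv₀ fun x => (hpos x).ne')
  refine ⟨⟨ι, b.c, fun i => ⟨b i, (b i).contMDiff⟩, fun i => ⟨_, hχ i⟩,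
    fun i => (b i).hasCompactSupport, hb, fun i => closure_mono fun x hx h => hx ?_,
    b.locallyFinite, fun x => ?_⟩⟩
  · change b i x = 0 at h
    change b i x * _ = 0
    rw [h, zero_mul]
  · change ∑ᶠ i, b i x * (∑ᶠ i, (b i x) ^ 3)⁻¹ * b i x * b i x = 1
    have : ∀ i, b i x * (∑ᶠ i, (b i x) ^ 3)⁻¹ * b i x * b i x =
        (∑ᶠ i, (b i x) ^ 3)⁻¹ * (b i x) ^ 3 := fun i => by ring
    simp only [this]
    rw [← mul_finsum, inv_mul_cancel₀ (hpos x).ne']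

namespace QuadraticPartition

variable {U : M → Set M} (P : QuadraticPartition E U)

lemma hasCompactSupport_χ (i : P.ι) : HasCompactSupport (P.χ i) :=
  (P.hasCompactSupport i).of_isClosed_subset (isClosed_tsupport _) (P.tsupport_χ_subset i)

lemma finite_inter (C : TopologicalSpace.Compacts M) :
    {i | (Function.support (P.f i) ∩ C).Nonempty}.Finite :=
  P.locallyFinite.finite_nonempty_inter_compact C.isCompact

/-- The indices of the functions that do not vanish on a compact set. -/
def indices (C : TopologicalSpace.Compacts M) : Finset P.ι := (P.finite_inter C).toFinset

lemma f_eq_zero {C : TopologicalSpace.Compacts M} {i : P.ι} (hi : i ∉ P.indices C) {x : M}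
    (hx : x ∈ C) : P.f i x = 0 := by
  by_contra h
  exact hi ((P.finite_inter C).mem_toFinset.2 ⟨x, h, hx⟩)

lemma sum_indices {C : TopologicalSpace.Compacts M} {x : M} (hx : x ∈ C) :
    ∑ i ∈ P.indices C, P.χ i x * P.f i x * P.f i x = 1 := by
  rw [← P.sum_eq_one x]
  refine (finsum_eq_sum_of_support_subset _ fun i hi => ?_).symm
  by_contra h
  exact hi (by simp only [P.f_eq_zero h hx, mul_zero])

end QuadraticPartition

end QuadraticPartition

/-! ### Locally finite sums of seminorms on compactly supported sections -/

section LocallyFiniteSums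

attribute [local instance] smoothSectionTopology

variable {E : Type*} [NormedAddCommGroup E] [NormedSpace ℝ E]
  {M : Type*} [TopologicalSpace M] [ChartedSpace E M] [IsManifold 𝓘(ℝ, E) ∞ M]
  {F : Type*} [NormedAddCommGroup F] [NormedSpace ℝ F]
  {V : M → Type*} [∀ x, AddCommGroup (V x)] [∀ x, Module ℝ (V x)]
  [TopologicalSpace (TotalSpace F V)] [∀ x, TopologicalSpace (V x)]
  [FiberBundle F V] [VectorBundle ℝ F V] [ContMDiffVectorBundle ∞ F V 𝓘(ℝ, E)]

instance : LocallyConvexSpace ℝ (SmoothSection E F V) :=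
  (withSeminorms_smoothSection E F V).toLocallyConvexSpace

namespace CompactSection

/-- The support of a compactly supported section. -/
def supportCompacts (s : CompactSection E F V) : TopologicalSpace.Compacts M :=
  ⟨sectionSupport s, s.isCompact_support⟩

lemma eq_zero_of_notMem {s : ∀ x, V x} {C : Set M} (hs : sectionSupport s ⊆ C) {x : M}
    (hx : x ∉ C) : s x = 0 :=
  by_contra fun h => hx (hs (subset_closure h))

lemma continuous_toSmooth [T2Space M] : Continuous (toSmooth E F V) :=
  continuous_of_seminorm_le _ fun p hp _ => ⟨p, hp, fun _ _ => le_rfl⟩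

lemma sum_apply {ι : Type*} (S : Finset ι) (s : ι → CompactSection E F V) (x : M) :
    (∑ i ∈ S, s i) x = ∑ i ∈ S, s i x := by
  classical
  induction S using Finset.induction_on with
  | empty => rfl
  | insert i S hi h => rw [Finset.sum_insert hi, Finset.sum_insert hi, add_apply, h]

/-- Locally finite sums of continuous seminorms are bounded by continuous seminorms. -/
lemma exists_seminorm_sum_le [T2Space M] {U : M → Set M} (P : QuadraticPartition E U)
    (q : P.ι → Seminorm ℝ (SmoothSection E F V)) (hq : ∀ i, Continuous (q i)) :
    ∃ Q : Seminorm ℝ (CompactSection E F V), Continuous Q ∧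
      ∀ (s : CompactSection E F V) (S : Finset P.ι),
        ∑ i ∈ S, q i (toSmooth E F V (cutoff (P.f i) (P.hasCompactSupport i)
          (toSmooth E F V s))) ≤ Q s := by
  let T : P.ι → SmoothSection E F V →ₗ[ℝ] SmoothSection E F V := fun i =>
    toSmooth E F V ∘ₗ cutoff (P.f i) (P.hasCompactSupport i)
  have hT : ∀ i, Continuous (T i) := fun i => continuous_toSmooth.comp (continuous_cutoff _ _)
  -- The majorant is the supremum of all finite partial sums. On sections supported in `C` only the
  -- finitely many `f i` that do not vanish identically on `C` contribute, so there it is bounded by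
  -- one finite sum. This gives both finiteness and continuity.
  let r : Finset P.ι → Seminorm ℝ (CompactSection E F V) := fun S =>
    ∑ i ∈ S, (q i).comp (T i ∘ₗ toSmooth E F V)
  have hr : ∀ S s, r S s = ∑ i ∈ S, q i (T i (toSmooth E F V s)) := fun S s =>
    Seminorm.finsetSum_apply _ _ _
  have hbound : ∀ (C : TopologicalSpace.Compacts M) (s : CompactSection E F V),
      sectionSupport s ⊆ C → ∀ S, r S s ≤ ∑ i ∈ P.indices C, q i (T i (toSmooth E F V s)) := by
    classical
    intro C s hs S
    rw [hr]
    refine (Finset.sum_le_sum_of_subset_of_nonneg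
      (Finset.subset_union_left (s₂ := P.indices C)) fun i _ _ => apply_nonneg _ _).trans
      (Finset.sum_subset Finset.subset_union_right fun i _ hi => ?_).ge
    have : T i (toSmooth E F V s) = 0 := by
      ext x
      change P.f i x • s x = 0
      by_cases hx : x ∈ C
      · rw [P.f_eq_zero hi hx, zero_smul]
      · rw [eq_zero_of_notMem hs hx, smul_zero]
    rw [this, map_zero]
  have hbdd : BddAbove (range r) := Seminorm.bddAbove_range_iff.2 fun s =>
    ⟨_, by rintro _ ⟨S, rfl⟩; exact hbound s.supportCompacts s subset_rfl S⟩
  refine ⟨⨆ S, r S, continuous_seminorm_of_le _ fun C => ?_, fun s S => ?_⟩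
  · refine ⟨∑ i ∈ P.indices C, (q i).comp (T i),
      Seminorm.continuous_finsetSum fun i _ => (hq i).comp (hT i), fun s hs => ?_⟩
    rw [Seminorm.iSup_apply hbdd, Seminorm.finsetSum_apply]
    exact ciSup_le (hbound C s hs)
  · rw [Seminorm.iSup_apply hbdd]
    refine le_trans (le_of_eq (hr S s).symm) ?_
    exact le_ciSup (f := fun S => r S s) (Seminorm.bddAbove_range_iff.1 hbdd s) S

end CompactSection

end LocallyFiniteSums

/-! ### Joint continuity of `κ̃_K` -/

section OneFormForm

attribute [local instance] smoothSectionTopology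

variable {E : Type*} [NormedAddCommGroup E] [NormedSpace ℝ E] [FiniteDimensional ℝ E]
  {M : Type*} [TopologicalSpace M] [ChartedSpace E M] [IsManifold 𝓘(ℝ, E) ∞ M]
  {F : Type*} [NormedAddCommGroup F] [NormedSpace ℝ F]
  {g : Type*} [LieRing g] [LieAlgebra ℝ g] [FiniteDimensional ℝ g]
  {K : M → Type*} [∀ x, LieRing (K x)] [∀ x, LieAlgebra ℝ (K x)]
  [TopologicalSpace (TotalSpace F K)] [∀ x, TopologicalSpace (K x)]
  [FiberBundle F K] [VectorBundle ℝ F K] [ContMDiffVectorBundle ∞ F K 𝓘(ℝ, E)]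
  [IsLieAlgebraBundle F g K]
  [∀ x, IsTopologicalAddGroup (K x)] [∀ x, ContinuousSMul ℝ (K x)]

/-- The atlas of `V(K)` contains only trivializations induced from Lie trivializations, and the
atlas of a Hom bundle only those built from pairs. So every defining seminorm on one-forms is taken
in coordinates where `κ` is constant. -/
lemma exists_eq_continuousLinearMap_formTriv
    (e : Trivialization (E →L[ℝ] UniversalFormModel g) (π (E →L[ℝ] UniversalFormModel g)
      fun x : M => TangentSpace 𝓘(ℝ, E) x →L[ℝ] UniversalFormFiber F g K x))
    [he : MemTrivializationAtlas e] :
    ∃ (e₁ : Trivialization E (π E (TangentSpace 𝓘(ℝ, E) : M → Type _)))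
      (_ : MemTrivializationAtlas e₁) (τ : LieTrivialization F g K),
      e = e₁.continuousLinearMap (RingHom.id ℝ) τ.formTriv := by
  obtain ⟨e', ⟨e₁, e₂, h1, h2, rfl⟩, h⟩ := he.out
  obtain ⟨_, ⟨τ, rfl⟩, rfl⟩ := h2.out
  exact ⟨e₁, h1, τ, h⟩

/-- The map `κ̃` in local trivializations. -/
def LieTrivialization.oneFormBilin (τ : LieTrivialization F g K) :
    (E →L[ℝ] F) →ₗ[ℝ] F →ₗ[ℝ] (E →L[ℝ] UniversalFormModel g) :=
  LinearMap.mk₂ ℝ (fun A a => (LinearMap.toContinuousLinearMap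
    (τ.formBilin.flip a ∘ₗ (A : E →ₗ[ℝ] F))))
    (fun A A' a => by ext; simp) (fun c A a => by ext; simp)
    (fun A a a' => by ext; simp) (fun c A a => by ext; simp)

/-- A Lie trivialization is a fiberwise Lie homomorphism, and `κ` is natural in such homomorphisms.
The tangent trivialization enters both sides by the same precomposition, so `y` need not lie in its
base set. -/
lemma continuousLinearMap_formTriv_oneFormForm
    (e₁ : Trivialization E (π E (TangentSpace 𝓘(ℝ, E) : M → Type _))) [MemTrivializationAtlas e₁]
    (τ : LieTrivialization F g K) (α : CompactOneForm E F K) (s : CompactSection E F K) {y : M}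
    (hy : y ∈ τ.triv.baseSet) :
    (e₁.continuousLinearMap (RingHom.id ℝ) τ.formTriv ⟨y, oneFormForm E F g K α s y⟩).2 =
      τ.oneFormBilin (e₁.continuousLinearMap (RingHom.id ℝ) τ.triv ⟨y, α y⟩).2
        (τ.triv ⟨y, s y⟩).2 := by
  ext1 v
  have hy' : y ∈ τ.formTriv.baseSet := hy
  simp only [Trivialization.continuousLinearMap_apply, LieTrivialization.oneFormBilin,
    LinearMap.mk₂_apply,
    ContinuousLinearMap.comp_apply, LinearMap.coe_toContinuousLinearMap', LinearMap.comp_apply,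
    LinearMap.flip_apply, ContinuousLinearMap.coe_coe,
    Trivialization.continuousLinearMapAt_apply, Trivialization.linearMapAt_apply, if_pos hy,
    if_pos hy']
  exact τ.formHom_fiberForm hy _ _

/-- With the same chart, order and compact set on all three bundles, `κ̃` is a constant bilinear map
between local representations, and the Leibniz estimate applies. -/
lemma exists_sectionSeminorm_oneFormForm_le (i : SectionSeminormIndex E
    (E →L[ℝ] UniversalFormModel g)
    (fun x : M => TangentSpace 𝓘(ℝ, E) x →L[ℝ] UniversalFormFiber F g K x)) :
    ∃ (q : Seminorm ℝ (SmoothSection E (E →L[ℝ] F)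
        (fun x : M => TangentSpace 𝓘(ℝ, E) x →L[ℝ] K x)))
      (r : Seminorm ℝ (SmoothSection E F K)), Continuous q ∧ Continuous r ∧
      ∀ (α : CompactOneForm E F K) (s : CompactSection E F K),
        i.seminorm (CompactSection.toSmooth _ _ _ (oneFormForm E F g K α s)) ≤
          q (CompactSection.toSmooth _ _ _ α) * r (CompactSection.toSmooth _ _ _ s) := by
  obtain ⟨e₁, he₁, τ, he⟩ := exists_eq_continuousLinearMap_formTriv i.triv
  have := τ.finiteDimensional
  have hsub : i.domain = i.chart.target ∩ i.chart.symm ⁻¹' (e₁.baseSet ∩ τ.triv.baseSet) := by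
    rw [SectionSeminormIndex.domain, he]
    rfl
  let j : SectionSeminormIndex E (E →L[ℝ] F) (fun x : M => TangentSpace 𝓘(ℝ, E) x →L[ℝ] K x) :=
    { triv := e₁.continuousLinearMap (RingHom.id ℝ) τ.triv
      triv_mem := inferInstance
      chart := i.chart
      chart_mem := i.chart_mem
      order := i.order
      set := i.set
      isCompact := i.isCompact
      subset := i.subset.trans hsub.subset }
  let k : SectionSeminormIndex E F K :=
    { triv := τ.triv
      triv_mem := inferInstance
      chart := i.chart
      chart_mem := i.chart_mem
      order := i.order
      set := i.set
      isCompact := i.isCompact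
      subset := fun z hz => ⟨(i.subset hz).1, (hsub.subset (i.subset hz)).2.2⟩ }
  obtain ⟨q, r, hq, hr, h⟩ := i.exists_seminorm_le_mul j k
    (τ.oneFormBilin (E := E)).toContinuousBilinearMap i.isOpen_domain i.subset subset_rfl subset_rfl
    hsub.subset (fun z hz => ⟨(hsub.subset hz).1, (hsub.subset hz).2.2⟩)
  refine ⟨q, r, hq, hr, fun α s => h _ _ _ fun z hz => ?_⟩
  rw [SectionSeminormIndex.rep, he]
  exact continuousLinearMap_formTriv_oneFormForm e₁ τ α s (hsub.subset hz).2.2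

lemma exists_seminorm_oneFormForm_le (p : Seminorm ℝ (SmoothSection E
    (E →L[ℝ] UniversalFormModel g)
    (fun x : M => TangentSpace 𝓘(ℝ, E) x →L[ℝ] UniversalFormFiber F g K x)))
    (hp : Continuous p) :
    ∃ (q : Seminorm ℝ (SmoothSection E (E →L[ℝ] F)
        (fun x : M => TangentSpace 𝓘(ℝ, E) x →L[ℝ] K x)))
      (r : Seminorm ℝ (SmoothSection E F K)), Continuous q ∧ Continuous r ∧
      ∀ (α : CompactOneForm E F K) (s : CompactSection E F K),
        p (CompactSection.toSmooth _ _ _ (oneFormForm E F g K α s)) ≤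
          q (CompactSection.toSmooth _ _ _ α) * r (CompactSection.toSmooth _ _ _ s) := by
  obtain ⟨S, c, hc, hle⟩ := exists_le_sum_sectionSeminorm hp
  lift c to NNReal using hc
  choose q r hq hr h using fun i : SectionSeminormIndex E (E →L[ℝ] UniversalFormModel g)
    (fun x : M => TangentSpace 𝓘(ℝ, E) x →L[ℝ] UniversalFormFiber F g K x) =>
      exists_sectionSeminorm_oneFormForm_le i
  refine ⟨c • ∑ i ∈ S, q i, ∑ i ∈ S, r i,
    (Seminorm.continuous_finsetSum fun i _ => hq i).const_smul c,
    Seminorm.continuous_finsetSum fun i _ => hr i, fun α s => (hle _).trans ?_⟩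
  have h1 : (c • ∑ i ∈ S, q i) (CompactSection.toSmooth _ _ _ α) =
      c * (∑ i ∈ S, q i) (CompactSection.toSmooth _ _ _ α) := rfl
  rw [h1, mul_assoc, Seminorm.finsetSum_apply, Seminorm.finsetSum_apply, Finset.sum_mul]
  refine mul_le_mul_of_nonneg_left (Finset.sum_le_sum fun i hi => (h i α s).trans ?_) c.2
  exact mul_le_mul_of_nonneg_left (Finset.single_le_sum
    (f := fun i => r i (CompactSection.toSmooth _ _ _ s)) (fun _ _ => apply_nonneg _ _) hi)
    (apply_nonneg _ _)

/-- The map `κ̃_K` is jointly continuous. -/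
theorem continuous_oneFormForm [T2Space M] [SigmaCompactSpace M] :
    Continuous fun z : CompactOneForm E F K × CompactSection E F K =>
      oneFormForm E F g K z.1 z.2 := by
  obtain ⟨P⟩ := exists_quadraticPartition (E := E) (M := M) (fun _ => univ)
    fun _ => Filter.univ_mem
  refine LinearMap.continuous₂_of_seminorm_le_mul (p := gaugeSeminormFamily ℝ
    (CompactOneForm E (UniversalFormModel g) (UniversalFormFiber F g K)))
    with_gaugeSeminormFamily _ fun a => ?_
  have hp := (with_gaugeSeminormFamily (𝕜 := ℝ)
    (E := CompactOneForm E (UniversalFormModel g) (UniversalFormFiber F g K))).continuous_seminorm a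
  generalize gaugeSeminormFamily ℝ
    (CompactOneForm E (UniversalFormModel g) (UniversalFormFiber F g K)) a = p at hp
  -- After multiplication by `χ i`, the seminorm `p` becomes continuous on all of `C^∞`, so the
  -- local estimates apply to it, with seminorms depending on `i`.
  choose q r hq hr h using fun i => exists_seminorm_oneFormForm_le
    (p.comp (CompactSection.cutoff (P.χ i) (P.hasCompactSupport_χ i)))
    (hp.comp (CompactSection.continuous_cutoff _ _))
  obtain ⟨Q, hQ, hqQ⟩ := CompactSection.exists_seminorm_sum_le P q hq
  obtain ⟨R, hR, hrR⟩ := CompactSection.exists_seminorm_sum_le P r hr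
  refine ⟨Q, R, hQ, hR, fun α s => ?_⟩
  set C := s.supportCompacts with hC
  let α' := fun i => CompactSection.cutoff (P.f i) (P.hasCompactSupport i)
    (CompactSection.toSmooth _ _ _ α)
  let s' := fun i => CompactSection.cutoff (P.f i) (P.hasCompactSupport i)
    (CompactSection.toSmooth _ _ _ s)
  -- By bilinearity each summand is `χ_i f_i²` times `κ̃_K(α, s)`. These weights add up to one on
  -- the support of `s`, and elsewhere both sides are zero.
  have hsum : oneFormForm E F g K α s = ∑ i ∈ P.indices C,
      CompactSection.cutoff (P.χ i) (P.hasCompactSupport_χ i)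
        (CompactSection.toSmooth _ _ _ (oneFormForm E F g K (α' i) (s' i))) := by
    ext x v
    rw [CompactSection.sum_apply, _root_.sum_apply]
    have h1 : ∀ i, CompactSection.cutoff (P.χ i) (P.hasCompactSupport_χ i)
        (CompactSection.toSmooth _ _ _ (oneFormForm E F g K (α' i) (s' i))) x v =
        (P.χ i x * P.f i x * P.f i x) • fiberForm F g K x (α x v) (s x) := by
      intro i
      change P.χ i x • fiberForm F g K x (P.f i x • α x v) (P.f i x • s x) = _
      rw [map_smul, map_smul, LinearMap.smul_apply, smul_smul, smul_smul, mul_assoc]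
    simp only [h1]
    rw [← Finset.sum_smul]
    by_cases hx : x ∈ C
    · rw [P.sum_indices hx, one_smul]
      rfl
    · have : s x = 0 := CompactSection.eq_zero_of_notMem subset_rfl hx
      rw [oneFormForm_apply, this, map_zero, smul_zero]
  calc p (oneFormForm E F g K α s)
      ≤ ∑ i ∈ P.indices C, p (CompactSection.cutoff (P.χ i) (P.hasCompactSupport_χ i)
        (CompactSection.toSmooth _ _ _ (oneFormForm E F g K (α' i) (s' i)))) := by
        rw [hsum]
        exact Finset.le_sum_of_subadditive p (map_zero p).le (map_add_le_add p) _ _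
    _ ≤ ∑ i ∈ P.indices C, q i (CompactSection.toSmooth _ _ _ (α' i)) *
          r i (CompactSection.toSmooth _ _ _ (s' i)) :=
        Finset.sum_le_sum fun i _ => h i (α' i) (s' i)
    -- Each single factor `r i` is at most `R s`, by the bound for the one-element set `{i}`; the
    -- remaining sum of the `q i` is at most `Q α`.
    _ ≤ ∑ i ∈ P.indices C, q i (CompactSection.toSmooth _ _ _ (α' i)) * R s := by
        refine Finset.sum_le_sum fun i _ => mul_le_mul_of_nonneg_left ?_ (apply_nonneg _ _)
        simpa using hrR s {i}
    _ ≤ Q α * R s := by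
        rw [← Finset.sum_mul]
        exact mul_le_mul_of_nonneg_right (hqQ α _) (apply_nonneg _ _)

end OneFormForm

/-! ### The derivation of `V(L)` induced by a derivation of `L` -/

section Derivation

variable {L : Type*} [LieRing L] [LieAlgebra ℝ L]

/-- The endomorphism of `V(L)` with `κ(x, y) ↦ κ(δ x, y) + κ(x, δ y)`, for a derivation `δ`. -/
def UniversalFormSpace.derivation (δ : L →ₗ[ℝ] L) (hδ : ∀ x y, δ ⁅x, y⁆ = ⁅δ x, y⁆ + ⁅x, δ y⁆) :
    UniversalFormSpace L →ₗ[ℝ] UniversalFormSpace L :=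
  (invariantRelations L).liftQ
    (TensorProduct.lift ((universalForm L).compl₁₂ δ LinearMap.id +
      (universalForm L).compl₁₂ LinearMap.id δ)) (by
    refine Submodule.span_le.2 ?_
    rintro u (⟨x, y, rfl⟩ | ⟨x, y, z, rfl⟩)
    · simp only [SetLike.mem_coe, LinearMap.mem_ker, map_sub, TensorProduct.lift.tmul,
        LinearMap.add_apply, LinearMap.compl₁₂_apply, LinearMap.id_apply]
      rw [universalForm_symm y, universalForm_symm (δ y)]
      abel
    · simp only [SetLike.mem_coe, LinearMap.mem_ker, map_sub, TensorProduct.lift.tmul,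
        LinearMap.add_apply, LinearMap.compl₁₂_apply, LinearMap.id_apply, hδ, map_add,
        universalForm_invariant]
      abel)

end Derivation

/-! ### Derivatives of sections in a local trivialization -/

section MVFDeriv

variable {E : Type*} [NormedAddCommGroup E] [NormedSpace ℝ E]
  {M : Type*} [TopologicalSpace M] [ChartedSpace E M]

lemma Filter.EventuallyEq.mvfderiv_eq {F : Type*} [NormedAddCommGroup F] [NormedSpace ℝ F]
    {u w : M → F} {x : M} (h : u =ᶠ[𝓝 x] w) :
    mvfderiv 𝓘(ℝ, E) u x = mvfderiv 𝓘(ℝ, E) w x :=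
  (h.mfderiv_eq : _)

lemma mvfderiv_bilinear {A B C : Type*} [NormedAddCommGroup A] [NormedSpace ℝ A]
    [NormedAddCommGroup B] [NormedSpace ℝ B] [NormedAddCommGroup C] [NormedSpace ℝ C]
    (b : A →L[ℝ] B →L[ℝ] C) {u : M → A} {w : M → B} {x : M}
    (hu : MDifferentiableAt 𝓘(ℝ, E) 𝓘(ℝ, A) u x) (hw : MDifferentiableAt 𝓘(ℝ, E) 𝓘(ℝ, B) w x)
    (v : TangentSpace 𝓘(ℝ, E) x) :
    mvfderiv 𝓘(ℝ, E) (fun y => b (u y) (w y)) x v =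
      b (mvfderiv 𝓘(ℝ, E) u x v) (w x) + b (u x) (mvfderiv 𝓘(ℝ, E) w x v) := by
  have hb : MDifferentiableAt 𝓘(ℝ, E) 𝓘(ℝ, C) (fun y => b (u y) (w y)) x := by
    have h := b.isBoundedBilinearMap.contDiff (n := 1)
    exact (h.contMDiff.mdifferentiableAt one_ne_zero).comp x (hu.prodMk_space hw)
  rw [hb.mvfderiv, hu.mvfderiv, hw.mvfderiv]
  have h := b.fderivWithin_of_bilinear hu.differentiableWithinAt_writtenInExtChartAt
    hw.differentiableWithinAt_writtenInExtChartAt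
    (𝓘(ℝ, E).uniqueDiffOn _ (mem_range_self (extChartAt 𝓘(ℝ, E) x x)))
  have hux : writtenInExtChartAt 𝓘(ℝ, E) 𝓘(ℝ, A) x u (extChartAt 𝓘(ℝ, E) x x) = u x := by
    simp [writtenInExtChartAt, chartAt_self_eq]
  have hwx : writtenInExtChartAt 𝓘(ℝ, E) 𝓘(ℝ, B) x w (extChartAt 𝓘(ℝ, E) x x) = w x := by
    simp [writtenInExtChartAt, chartAt_self_eq]
  rw [hux, hwx] at h
  exact (congrArg (fun T : E →L[ℝ] C => T v) h).trans (add_comm _ _)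

lemma contMDiff_mul_of_tsupport_subset {h : M → ℝ} (hh : ContMDiff 𝓘(ℝ, E) 𝓘(ℝ) ∞ h)
    {u : M → ℝ} {U : Set M} (hU : IsOpen U) (hhU : tsupport h ⊆ U)
    (hu : ContMDiffOn 𝓘(ℝ, E) 𝓘(ℝ) ∞ u U) :
    ContMDiff 𝓘(ℝ, E) 𝓘(ℝ) ∞ fun x => h x * u x :=
  contMDiff_of_tsupport fun _ hx => hh.contMDiffAt.mul
    (hu.contMDiffAt (hU.mem_nhds (hhU (tsupport_mul_subset_left hx))))

variable [IsManifold 𝓘(ℝ, E) ∞ M]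
  {F : Type*} [NormedAddCommGroup F] [NormedSpace ℝ F]
  {V : M → Type*} [∀ x, AddCommGroup (V x)] [∀ x, Module ℝ (V x)]
  [TopologicalSpace (TotalSpace F V)] [∀ x, TopologicalSpace (V x)]
  [FiberBundle F V] [VectorBundle ℝ F V] [ContMDiffVectorBundle ∞ F V 𝓘(ℝ, E)]

lemma CompactSection.mdifferentiableAt_triv (e : Trivialization F (π F V))
    [MemTrivializationAtlas e] (s : CompactSection E F V) {x : M} (hx : x ∈ e.baseSet) :
    MDifferentiableAt 𝓘(ℝ, E) 𝓘(ℝ, F) (fun y => (e ⟨y, s y⟩).2) x :=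
  ((e.contMDiffAt_section_iff hx).1 (s.contMDiff x)).mdifferentiableAt (by simp)

/-- The derivative of a section at a point in a local trivialization. -/
def CompactSection.localDeriv (e : Trivialization F (π F V)) [MemTrivializationAtlas e] {x : M}
    (hx : x ∈ e.baseSet) (v : TangentSpace 𝓘(ℝ, E) x) : CompactSection E F V →ₗ[ℝ] F where
  toFun s := mvfderiv 𝓘(ℝ, E) (fun y => (e ⟨y, s y⟩).2) x v
  map_add' s t := by
    have h : (fun y => (e ⟨y, (s + t) y⟩).2) =ᶠ[𝓝 x]
        (fun y => (e ⟨y, s y⟩).2) + fun y => (e ⟨y, t y⟩).2 := by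
      filter_upwards [e.open_baseSet.mem_nhds hx] with y hy
      exact (e.linear ℝ hy).map_add _ _
    rw [h.mvfderiv_eq, mvfderiv_add (s.mdifferentiableAt_triv e hx) (t.mdifferentiableAt_triv e hx)]
    rfl
  map_smul' c s := by
    have h : (fun y => (e ⟨y, (c • s) y⟩).2) =ᶠ[𝓝 x]
        (fun _ : M => c) • fun y => (e ⟨y, s y⟩).2 := by
      filter_upwards [e.open_baseSet.mem_nhds hx] with y hy
      exact (e.linear ℝ hy).map_smul _ _
    rw [h.mvfderiv_eq, mvfderiv_smul mdifferentiableAt_const (s.mdifferentiableAt_triv e hx),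
      mvfderiv_const]
    simp

lemma CompactSection.localDeriv_apply (e : Trivialization F (π F V)) [MemTrivializationAtlas e]
    {x : M} (hx : x ∈ e.baseSet) (v : TangentSpace 𝓘(ℝ, E) x) (s : CompactSection E F V) :
    localDeriv e hx v s = mvfderiv 𝓘(ℝ, E) (fun y => (e ⟨y, s y⟩).2) x v := rfl

/-- This is the rule of a Koszul connection, so the terms with `df` cancel when the coordinate
derivative is subtracted from such a connection. -/
lemma CompactSection.localDeriv_smul (e : Trivialization F (π F V)) [MemTrivializationAtlas e]
    {x : M} (hx : x ∈ e.baseSet) (v : TangentSpace 𝓘(ℝ, E) x) (f : C^∞⟮𝓘(ℝ, E), M; 𝓘(ℝ), ℝ⟯)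
    (s : CompactSection E F V) :
    localDeriv e hx v (f • s) =
      f x • localDeriv e hx v s + mvfderiv 𝓘(ℝ, E) f x v • (e ⟨x, s x⟩).2 := by
  have h : (fun y => (e ⟨y, (f • s) y⟩).2) =ᶠ[𝓝 x] (f : M → ℝ) • fun y => (e ⟨y, s y⟩).2 := by
    filter_upwards [e.open_baseSet.mem_nhds hx] with y hy
    exact (e.linear ℝ hy).map_smul _ _
  rw [localDeriv_apply, h.mvfderiv_eq, mvfderiv_smul
    (f.contMDiff.mdifferentiableAt (by simp)) (s.mdifferentiableAt_triv e hx)]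
  rfl

end MVFDeriv

/-! ### Tensoriality -/

section Tensoriality

variable {E : Type*} [NormedAddCommGroup E] [NormedSpace ℝ E]
  {M : Type*} [TopologicalSpace M] [ChartedSpace E M] [IsManifold 𝓘(ℝ, E) ∞ M]
  {F : Type*} [NormedAddCommGroup F] [NormedSpace ℝ F]
  {V : M → Type*} [∀ x, AddCommGroup (V x)] [∀ x, Module ℝ (V x)]
  [TopologicalSpace (TotalSpace F V)] [∀ x, TopologicalSpace (V x)]
  [FiberBundle F V] [VectorBundle ℝ F V] [ContMDiffVectorBundle ∞ F V 𝓘(ℝ, E)]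

lemma exists_smooth_bump [FiniteDimensional ℝ E] [T2Space M] {U : Set M} {x : M}
    (hU : U ∈ 𝓝 x) :
    ∃ h : C^∞⟮𝓘(ℝ, E), M; 𝓘(ℝ), ℝ⟯, HasCompactSupport h ∧ tsupport h ⊆ U ∧ h x = 1 := by
  obtain ⟨b, -, hb⟩ := (SmoothBumpFunction.nhds_basis_tsupport (I := 𝓘(ℝ, E)) x).mem_iff.1 hU
  exact ⟨⟨b, b.contMDiff⟩, b.hasCompactSupport, hb, b.eq_one⟩

namespace CompactSection

/-- The sections that are constant in a local trivialization, cut off by a smooth function. -/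
def frame (e : Trivialization F (π F V)) [MemTrivializationAtlas e]
    (h : C^∞⟮𝓘(ℝ, E), M; 𝓘(ℝ), ℝ⟯) (hc : HasCompactSupport h) (hh : tsupport h ⊆ e.baseSet) :
    F →ₗ[ℝ] CompactSection E F V where
  toFun a := ofLocal e h hc e.open_baseSet hh subset_rfl (fun _ => a) contMDiffOn_const
  map_add' a b := ext fun x => by simp
  map_smul' c a := ext fun x => by simp [smul_comm c]

@[simp] lemma frame_apply (e : Trivialization F (π F V)) [MemTrivializationAtlas e]
    (h : C^∞⟮𝓘(ℝ, E), M; 𝓘(ℝ), ℝ⟯) (hc : HasCompactSupport h) (hh : tsupport h ⊆ e.baseSet)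
    (a : F) (x : M) : frame e h hc hh a x = h x • e.symmₗ ℝ x a := rfl

/-- A linear map that is linear over smooth functions at a point depends only on the values
of sections at that point. -/
lemma eq_zero_of_tensorial [FiniteDimensional ℝ E] [FiniteDimensional ℝ F] [T2Space M]
    (e : Trivialization F (π F V)) [MemTrivializationAtlas e] {x : M} (hx : x ∈ e.baseSet)
    {X : Type*} [AddCommGroup X] [Module ℝ X] (N : CompactSection E F V →ₗ[ℝ] X)
    (hN : ∀ (f : C^∞⟮𝓘(ℝ, E), M; 𝓘(ℝ), ℝ⟯) (s : CompactSection E F V), N (f • s) = f x • N s)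
    {s : CompactSection E F V} (hs : s x = 0) : N s = 0 := by
  obtain ⟨h, hc, hh, h1⟩ := exists_smooth_bump (E := E) (e.open_baseSet.mem_nhds hx)
  let b := Module.finBasis ℝ F
  let a : Fin (Module.finrank ℝ F) → C^∞⟮𝓘(ℝ, E), M; 𝓘(ℝ), ℝ⟯ := fun k =>
    ⟨fun y => h y * b.coord k (e ⟨y, s y⟩).2,
      contMDiff_mul_of_tsupport_subset h.contMDiff e.open_baseSet hh
        ((LinearMap.toContinuousLinearMap (b.coord k)).contMDiff.comp_contMDiffOn
          (contMDiffOn_triv e s.1))⟩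
  -- Two factors `h` are spent: one extends the coordinates of `s` to global smooth functions, the
  -- other extends the frame to global sections. Since `h x = 1`, neither changes `N s`; each
  -- coefficient `a k` vanishes at `x`.
  have hdec : h • h • s = ∑ k, a k • frame e h hc hh (b k) := by
    ext y
    rw [sum_apply]
    by_cases hy : y ∈ e.baseSet
    · have hsy : s y = ∑ k, b.coord k (e ⟨y, s y⟩).2 • e.symmₗ ℝ y (b k) := by
        have h2 : s y = e.symmₗ ℝ y (e ⟨y, s y⟩).2 := by
          rw [← congrFun (e.coe_linearMapAt_of_mem (R := ℝ) hy) (s y), e.symmₗ_linearMapAt hy]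
        conv_lhs => rw [h2, ← b.sum_repr (e ⟨y, s y⟩).2]
        rw [map_sum]
        exact Finset.sum_congr rfl fun k _ => map_smul _ _ _
      change h y • h y • s y = ∑ k, (h y * b.coord k (e ⟨y, s y⟩).2) • h y • e.symmₗ ℝ y (b k)
      conv_lhs => rw [hsy, Finset.smul_sum, Finset.smul_sum]
      refine Finset.sum_congr rfl fun k _ => ?_
      simp only [smul_smul]
      congr 1
      ring
    · have hy0 : h y = 0 := image_eq_zero_of_notMem_tsupport fun hy' => hy (hh hy')
      simp [hy0]
  have h2 : N (h • h • s) = N s := by rw [hN, hN, h1, one_smul, one_smul]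
  rw [← h2, hdec, map_sum]
  refine Finset.sum_eq_zero fun k _ => ?_
  have hak : a k x = 0 := by
    have h3 : (e ⟨x, s x⟩).2 = 0 := by
      rw [hs]
      exact (e.linear ℝ hx).map_zero
    change h x * b.coord k (e ⟨x, s x⟩).2 = 0
    rw [h3, map_zero, mul_zero]
  rw [hN, hak, zero_smul]

end CompactSection

end Tensoriality

/-! ### The connection on `V(K)` at a point -/

section PointwiseConnection

variable {E : Type*} [NormedAddCommGroup E] [NormedSpace ℝ E] [FiniteDimensional ℝ E]
  {M : Type*} [TopologicalSpace M] [ChartedSpace E M] [IsManifold 𝓘(ℝ, E) ∞ M]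
  {F : Type*} [NormedAddCommGroup F] [NormedSpace ℝ F]
  {g : Type*} [LieRing g] [LieAlgebra ℝ g] [FiniteDimensional ℝ g]
  {K : M → Type*} [∀ x, LieRing (K x)] [∀ x, LieAlgebra ℝ (K x)]
  [TopologicalSpace (TotalSpace F K)] [∀ x, TopologicalSpace (K x)]
  [FiberBundle F K] [VectorBundle ℝ F K] [ContMDiffVectorBundle ∞ F K 𝓘(ℝ, E)]
  [IsLieAlgebraBundle F g K]
  [∀ x, IsTopologicalAddGroup (K x)] [∀ x, ContinuousSMul ℝ (K x)]

namespace LieTrivialization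

variable (τ : LieTrivialization F g K) {x : M} (hx : x ∈ τ.triv.baseSet)
  (v : TangentSpace 𝓘(ℝ, E) x) (D : CompactSection E F K →ₗ[ℝ] CompactOneForm E F K)

/-- The evaluation of `D s` on a tangent vector. -/
def evalConnection : CompactSection E F K →ₗ[ℝ] g where
  toFun s := τ.hom x (D s x v)
  map_add' s t := by rw [map_add, CompactSection.add_apply, add_apply, map_add]
  map_smul' c s := by
    rw [map_smul, CompactSection.smul_apply, _root_.smul_apply, map_smul]
    rfl

/-- The difference of `D` and the derivative in a Lie trivialization. -/
def connectionDefect : CompactSection E F K →ₗ[ℝ] g :=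
  τ.evalConnection v D - (τ.toLie : F →ₗ[ℝ] g) ∘ₗ CompactSection.localDeriv τ.triv hx v

lemma connectionDefect_apply (s : CompactSection E F K) :
    τ.connectionDefect hx v D s =
      τ.hom x (D s x v) - τ.toLie (CompactSection.localDeriv τ.triv hx v s) := rfl

variable {D}

lemma connectionDefect_smul (hD : IsKoszulConnection D) (f : C^∞⟮𝓘(ℝ, E), M; 𝓘(ℝ), ℝ⟯)
    (s : CompactSection E F K) :
    τ.connectionDefect hx v D (f • s) = f x • τ.connectionDefect hx v D s := by
  rw [connectionDefect_apply, connectionDefect_apply, hD, CompactSection.localDeriv_smul,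
    map_add, map_add, map_smul, map_smul, map_smul, map_smul, ← τ.hom_apply_of_mem hx]
  module

/-- The bracket is a constant bilinear map in a Lie trivialization, so the product rule has no term
differentiating the bracket itself. -/
lemma toLie_localDeriv_lie (s t : CompactSection E F K) :
    τ.toLie (CompactSection.localDeriv τ.triv hx v ⁅s, t⁆) =
      ⁅τ.toLie (CompactSection.localDeriv τ.triv hx v s), τ.hom x (t x)⁆ +
        ⁅τ.hom x (s x), τ.toLie (CompactSection.localDeriv τ.triv hx v t)⁆ := by
  have := τ.finiteDimensional
  let b := ((LieModule.toEnd ℝ g g : g →ₗ[ℝ] g →ₗ[ℝ] g).compl₁₂ (τ.toLie : F →ₗ[ℝ] g)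
      (τ.toLie : F →ₗ[ℝ] g)).compr₂ (τ.toLie.symm : g →ₗ[ℝ] F)
  have hb : ∀ u w, τ.toLie (b u w) = ⁅τ.toLie u, τ.toLie w⁆ := fun u w =>
    τ.toLie.apply_symm_apply _
  have h : (fun y => (τ.triv ⟨y, ⁅s, t⁆ y⟩).2) =ᶠ[𝓝 x]
      fun y => b.toContinuousBilinearMap (τ.triv ⟨y, s y⟩).2 (τ.triv ⟨y, t y⟩).2 := by
    filter_upwards [τ.triv.open_baseSet.mem_nhds hx] with y hy
    apply τ.toLie.injective
    exact (τ.map_lie y hy _ _).trans (hb _ _).symm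
  rw [CompactSection.localDeriv_apply, h.mvfderiv_eq, mvfderiv_bilinear _
    (s.mdifferentiableAt_triv τ.triv hx) (t.mdifferentiableAt_triv τ.triv hx), map_add]
  refine congrArg₂ (· + ·) ((hb _ _).trans ?_) ((hb _ _).trans ?_)
  · rw [← τ.hom_apply_of_mem hx]; rfl
  · rw [← τ.hom_apply_of_mem hx]; rfl

lemma connectionDefect_lie (hD : IsLieConnection D) (s t : CompactSection E F K) :
    τ.connectionDefect hx v D ⁅s, t⁆ =
      ⁅τ.connectionDefect hx v D s, τ.hom x (t x)⁆ +
        ⁅τ.hom x (s x), τ.connectionDefect hx v D t⁆ := by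
  simp only [connectionDefect_apply, hD.2, map_add, LieHom.map_lie, toLie_localDeriv_lie,
    sub_lie, lie_sub]
  abel

/-- The difference of `D` and the coordinate derivative is linear over functions, so it depends on
`s x` only and defines `δ`. Both operators obey the Leibniz rule for the bracket; evaluating the
difference on a bracket of sections with prescribed values at `x` shows that `δ` is a derivation. -/
lemma exists_derivation [T2Space M] (hD : IsLieConnection D) :
    ∃ δ : g →ₗ[ℝ] g, (∀ a b, δ ⁅a, b⁆ = ⁅δ a, b⁆ + ⁅a, δ b⁆) ∧
      ∀ s : CompactSection E F K, τ.hom x (D s x v) =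
        τ.toLie (CompactSection.localDeriv τ.triv hx v s) + δ (τ.hom x (s x)) := by
  have := τ.finiteDimensional
  obtain ⟨h, hc, hh, h1⟩ := exists_smooth_bump (E := E) (τ.triv.open_baseSet.mem_nhds hx)
  -- `j a` is a section with value `a` at `x`, constant in the trivialization up to the cut-off `h`.
  let j : g →ₗ[ℝ] CompactSection E F K :=
    CompactSection.frame τ.triv h hc hh ∘ₗ (τ.toLie.symm : g →ₗ[ℝ] F)
  have hj : ∀ a, τ.hom x (j a x) = a := by
    intro a
    change τ.hom x (h x • τ.inv x a) = a
    rw [h1, one_smul, τ.hom_inv hx]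
  let δ : g →ₗ[ℝ] g := τ.connectionDefect hx v D ∘ₗ j
  have hδ : ∀ s : CompactSection E F K,
      τ.connectionDefect hx v D s = δ (τ.hom x (s x)) := by
    intro s
    rw [← sub_eq_zero]
    change _ - τ.connectionDefect hx v D (j (τ.hom x (s x))) = 0
    rw [← map_sub]
    refine CompactSection.eq_zero_of_tensorial τ.triv hx _
      (τ.connectionDefect_smul hx v hD.1) ?_
    rw [CompactSection.sub_apply, ← τ.inv_hom hx (s x - _), map_sub, hj, sub_self, map_zero]
  refine ⟨δ, fun a b => ?_, fun s => ?_⟩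
  · have h2 := hδ ⁅j a, j b⁆
    rw [τ.connectionDefect_lie hx v hD, CompactSection.lie_apply, LieHom.map_lie, hj, hj] at h2
    exact h2.symm
  · rw [← hδ, connectionDefect_apply]
    abel

/-- The form `κ` is constant in the coordinates of a Lie trivialization, so this is the product
rule. -/
lemma localDeriv_sectionForm (s t : CompactSection E F K) :
    CompactSection.localDeriv (x := x) τ.formTriv hx v (sectionForm E F g K s t) =
      τ.formBilin (CompactSection.localDeriv τ.triv hx v s) (τ.triv ⟨x, t x⟩).2 +
        τ.formBilin (τ.triv ⟨x, s x⟩).2 (CompactSection.localDeriv τ.triv hx v t) := by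
  have := τ.finiteDimensional
  have h : (fun y => (τ.formTriv ⟨y, sectionForm E F g K s t y⟩).2) =ᶠ[𝓝 x]
      fun y => τ.formBilin.toContinuousBilinearMap (τ.triv ⟨y, s y⟩).2 (τ.triv ⟨y, t y⟩).2 := by
    filter_upwards [τ.triv.open_baseSet.mem_nhds hx] with y hy
    exact τ.formHom_fiberForm hy _ _
  refine (CompactSection.localDeriv_apply (x := x) τ.formTriv hx v _).trans ?_
  rw [h.mvfderiv_eq, mvfderiv_bilinear _
    (s.mdifferentiableAt_triv τ.triv hx) (t.mdifferentiableAt_triv τ.triv hx)]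
  rfl

/-- At every point, the form `β` is obtained from `κ` by a linear map. -/
lemma exists_linearMap_connectionForm [T2Space M] {x : M} (hx : x ∈ τ.triv.baseSet)
    (v : TangentSpace 𝓘(ℝ, E) x) (hD : IsLieConnection D) :
    ∃ P : CompactSection E (UniversalFormModel g) (UniversalFormFiber F g K) →ₗ[ℝ]
        UniversalFormModel g,
      ∀ s t : CompactSection E F K, P (sectionForm E F g K s t) =
        τ.formHom x (connectionForm D s t x v) := by
  obtain ⟨δ, hδ, hDδ⟩ := τ.exists_derivation hx v hD
  let ev : CompactSection E (UniversalFormModel g) (UniversalFormFiber F g K) →ₗ[ℝ]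
      UniversalFormFiber F g K x :=
    { toFun := fun s => s x, map_add' := fun _ _ => rfl, map_smul' := fun _ _ => rfl }
  -- `P` is the induced connection in coordinates: the derivative plus the endomorphism of `V(g)`
  -- that comes from `δ`. It acts on sections rather than on their values at `x`, since it
  -- differentiates.
  let P : CompactSection E (UniversalFormModel g) (UniversalFormFiber F g K) →ₗ[ℝ]
      UniversalFormModel g :=
    CompactSection.localDeriv (x := x) τ.formTriv hx v +
      (universalFormCoord g : _ →ₗ[ℝ] _) ∘ₗ UniversalFormSpace.derivation δ hδ ∘ₗ
        UniversalFormSpace.map (τ.hom x) ∘ₗ ev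
  refine ⟨P, fun s t => ?_⟩
  have h1 : P (sectionForm E F g K s t) =
      CompactSection.localDeriv (x := x) τ.formTriv hx v (sectionForm E F g K s t) +
        universalFormCoord g (universalForm g (δ (τ.hom x (s x))) (τ.hom x (t x)) +
          universalForm g (τ.hom x (s x)) (δ (τ.hom x (t x)))) := rfl
  have h2 : τ.formHom x (connectionForm D s t x v) =
      universalFormCoord g (universalForm g (τ.hom x (D s x v)) (τ.hom x (t x))) +
        universalFormCoord g (universalForm g (τ.hom x (s x)) (τ.hom x (D t x v))) := by
    rw [connectionForm_apply, map_add]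
    rfl
  have h3 : ∀ a b, τ.formBilin a b = universalFormCoord g
      (universalForm g (τ.toLie a) (τ.toLie b)) := fun _ _ => rfl
  rw [h1, h2, τ.localDeriv_sectionForm hx v, hDδ, hDδ, h3, h3, ← τ.hom_apply_of_mem hx,
    ← τ.hom_apply_of_mem hx]
  simp only [map_add, LinearMap.add_apply]
  abel

end LieTrivialization

end PointwiseConnection

/-! ### The induced connection on `V(K)` -/

section ContinuousBilinear

variable {X Y Z : Type*} [AddCommGroup X] [Module ℝ X] [AddCommGroup Y] [Module ℝ Y]
  [AddCommGroup Z] [Module ℝ Z] [TopologicalSpace X] [TopologicalSpace Y] [TopologicalSpace Z]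
  {B : X →ₗ[ℝ] Y →ₗ[ℝ] Z} {D : Y →ₗ[ℝ] X}

lemma LinearMap.continuous₂_comp (hB : Continuous fun z : X × Y => B z.1 z.2)
    (hD : Continuous D) : Continuous fun p : Y × Y => B (D p.1) p.2 :=
  hB.comp ((hD.comp continuous_fst).prodMk continuous_snd)

lemma LinearMap.continuous_comp_add_flip [ContinuousAdd Z]
    (hB : Continuous fun z : X × Y => B z.1 z.2) (hD : Continuous D) (s : Y) :
    Continuous ((B ∘ₗ D + (B ∘ₗ D).flip : Y →ₗ[ℝ] Y →ₗ[ℝ] Z) s) :=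
  (hB.comp (continuous_const.prodMk continuous_id : Continuous fun t : Y => (D s, t))).add
    (hB.comp (hD.prodMk continuous_const : Continuous fun t : Y => (D t, s)))

end ContinuousBilinear

/-! ### Spanning of sections of `V(K)` by values of `κ_K`, and descent of `β` -/

section InducedConnection

attribute [local instance] smoothSectionTopology

lemma TensorProduct.sum_tmul_lid_rTensor {R L ι : Type*} [CommRing R] [AddCommGroup L] [Module R L]
    [Fintype ι] (b : Module.Basis ι R L) (t : L ⊗[R] L) :
    ∑ k, b k ⊗ₜ[R] TensorProduct.lid R L (LinearMap.rTensor L (b.coord k) t) = t := by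
  induction t using TensorProduct.induction_on with
  | zero => simp
  | tmul x y =>
    simp only [LinearMap.rTensor_tmul, TensorProduct.lid_tmul, ← TensorProduct.smul_tmul]
    rw [← TensorProduct.sum_tmul]
    simp only [Module.Basis.coord_apply, b.sum_repr]
  | add x y hx hy => simp only [map_add, TensorProduct.tmul_add, Finset.sum_add_distrib, hx, hy]

variable {E : Type*} [NormedAddCommGroup E] [NormedSpace ℝ E] [FiniteDimensional ℝ E]
  {M : Type*} [TopologicalSpace M] [ChartedSpace E M] [IsManifold 𝓘(ℝ, E) ∞ M]
  {F : Type*} [NormedAddCommGroup F] [NormedSpace ℝ F]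
  {g : Type*} [LieRing g] [LieAlgebra ℝ g] [FiniteDimensional ℝ g]
  {K : M → Type*} [∀ x, LieRing (K x)] [∀ x, LieAlgebra ℝ (K x)]
  [TopologicalSpace (TotalSpace F K)] [∀ x, TopologicalSpace (K x)]
  [FiberBundle F K] [VectorBundle ℝ F K] [ContMDiffVectorBundle ∞ F K 𝓘(ℝ, E)]
  [IsLieAlgebraBundle F g K]

/-- Lift `w` linearly from `V(g)` to `g ⊗ g` and expand the lift in a basis of the left factor. The
left entries are then fixed, and the right entries depend linearly on `w`. -/
lemma LieTrivialization.exists_sum_formBilin (τ : LieTrivialization F g K) :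
    ∃ (a : Fin (Module.finrank ℝ g) → F)
      (L : Fin (Module.finrank ℝ g) → UniversalFormModel g →L[ℝ] F),
      ∀ w, ∑ k, τ.formBilin (a k) (L k w) = w := by
  obtain ⟨r, hr⟩ := (invariantRelations g).mkQ.exists_rightInverse_of_surjective
    (Submodule.range_mkQ _)
  let b := Module.finBasis ℝ g
  refine ⟨fun k => τ.toLie.symm (b k), fun k => LinearMap.toContinuousLinearMap
    ((τ.toLie.symm : g →ₗ[ℝ] F) ∘ₗ (TensorProduct.lid ℝ g : _ →ₗ[ℝ] g) ∘ₗ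
      LinearMap.rTensor g (b.coord k) ∘ₗ r ∘ₗ ((universalFormCoord g).symm : _ →ₗ[ℝ] _)),
    fun w => ?_⟩
  set t := r ((universalFormCoord g).symm w) with ht
  have h : ∀ k, τ.formBilin (τ.toLie.symm (b k)) (τ.toLie.symm
      (TensorProduct.lid ℝ g (LinearMap.rTensor g (b.coord k) t))) =
      universalFormCoord g ((invariantRelations g).mkQ
        (b k ⊗ₜ[ℝ] TensorProduct.lid ℝ g (LinearMap.rTensor g (b.coord k) t))) := by
    intro k
    change universalFormCoord g (universalForm g (τ.toLie (τ.toLie.symm _))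
      (τ.toLie (τ.toLie.symm _))) = _
    rw [LinearEquiv.apply_symm_apply, LinearEquiv.apply_symm_apply, universalForm_apply]
  refine (Finset.sum_congr rfl fun k _ => h k).trans ?_
  rw [← map_sum, ← map_sum, TensorProduct.sum_tmul_lid_rTensor, ht,
    show (invariantRelations g).mkQ (r _) = _ from LinearMap.congr_fun hr _]
  exact LinearEquiv.apply_symm_apply _ _

lemma LieTrivialization.formHom_injective (τ : LieTrivialization F g K) {y : M}
    (hy : y ∈ τ.triv.baseSet) : Function.Injective (τ.formHom y) :=
  Function.LeftInverse.injective (τ.formInv_formHom hy)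

/-- Sections of `V(K)` supported in a compact set are finite sums of values of `κ_K`, in a
continuous way. -/
lemma exists_sum_sectionForm [T2Space M] [SigmaCompactSpace M] (C : TopologicalSpace.Compacts M) :
    ∃ (n : ℕ) (φ : Fin n → CompactSection E F K)
      (T : Fin n → SmoothSection E (UniversalFormModel g) (UniversalFormFiber F g K) →ₗ[ℝ]
        CompactSection E F K), (∀ k, Continuous (T k)) ∧
      ∀ η : CompactSection E (UniversalFormModel g) (UniversalFormFiber F g K),
        sectionSupport η ⊆ C →
          ∑ k, sectionForm E F g K (φ k) (T k (CompactSection.toSmooth E _ _ η)) = η := by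
  choose τ hτ using IsLieAlgebraBundle.exists_triv (F := F) (g := g) (K := K)
  choose a L haL using fun x => (τ x).exists_sum_formBilin
  obtain ⟨P⟩ := exists_quadraticPartition (E := E) (fun x => (τ x).triv.baseSet)
    fun x => (τ x).triv.open_baseSet.mem_nhds (hτ x)
  have hsub : ∀ i, tsupport (P.χ i * P.f i : C^∞⟮𝓘(ℝ, E), M; 𝓘(ℝ), ℝ⟯) ⊆ tsupport (P.f i) :=
    fun i => closure_mono fun x hx h => hx (by
      change P.χ i x * P.f i x = 0
      rw [h, mul_zero])
  have hc : ∀ i, HasCompactSupport (P.χ i * P.f i : C^∞⟮𝓘(ℝ, E), M; 𝓘(ℝ), ℝ⟯) := fun i =>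
    (P.hasCompactSupport i).of_isClosed_subset (isClosed_tsupport _) (hsub i)
  -- The fiberwise decomposition is cut off by `χ_i f_i²`: one factor `f_i` makes the constant
  -- sections `a_k` global as `φ`, and `χ_i f_i` makes the coefficients `L_k η` global as `T`.
  -- Summing over `k` gives `χ_i f_i² η`, and over `i` gives `η`.
  let J := P.indices C × Fin (Module.finrank ℝ g)
  let φ : J → CompactSection E F K := fun j =>
    CompactSection.frame (τ (P.center j.1)).triv (P.f j.1) (P.hasCompactSupport j.1)
      (P.tsupport_subset j.1) (a (P.center j.1) j.2)
  let T : J → SmoothSection E (UniversalFormModel g) (UniversalFormFiber F g K) →ₗ[ℝ]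
      CompactSection E F K := fun j =>
    CompactSection.transfer (τ (P.center j.1)).formTriv (τ (P.center j.1)).triv
      (L (P.center j.1) j.2) (P.χ j.1 * P.f j.1) (hc j.1)
      fun x hx => ⟨P.tsupport_subset _ (hsub _ hx), P.tsupport_subset _ (hsub _ hx)⟩
  have hsum : ∀ η : CompactSection E (UniversalFormModel g) (UniversalFormFiber F g K),
      sectionSupport η ⊆ C →
        ∑ j, sectionForm E F g K (φ j) (T j (CompactSection.toSmooth E _ _ η)) = η := by
    intro η hη
    ext x
    rw [CompactSection.sum_apply]
    by_cases hx : x ∈ C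
    · have hi : ∀ i : P.indices C, ∑ k, sectionForm E F g K (φ (i, k))
          (T (i, k) (CompactSection.toSmooth E _ _ η)) x =
            (P.χ i x * P.f i x * P.f i x) • η x := by
        intro i
        by_cases hxi : x ∈ (τ (P.center i)).triv.baseSet
        · apply (τ (P.center i)).formHom_injective hxi
          rw [map_sum, map_smul]
          have h1 : ∀ c, ((τ (P.center i)).triv
              ⟨x, (τ (P.center i)).triv.symmₗ ℝ x c⟩).2 = c := by
            intro c
            rw [← congrFun ((τ (P.center i)).triv.coe_linearMapAt_of_mem (R := ℝ) hxi) _,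
              (τ (P.center i)).triv.linearMapAt_symmₗ hxi]
          have h2 : ∀ k, (τ (P.center i)).formHom x (sectionForm E F g K (φ (i, k))
              (T (i, k) (CompactSection.toSmooth E _ _ η)) x) =
              (P.χ i x * P.f i x * P.f i x) • (τ (P.center i)).formBilin (a (P.center i) k)
                (L (P.center i) k ((τ (P.center i)).formHom x (η x))) := by
            intro k
            have h3 : sectionForm E F g K (φ (i, k))
                (T (i, k) (CompactSection.toSmooth E _ _ η)) x =
                (P.χ i x * P.f i x * P.f i x) • fiberForm F g K x
                  ((τ (P.center i)).triv.symmₗ ℝ x (a (P.center i) k))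
                  ((τ (P.center i)).triv.symmₗ ℝ x
                    (L (P.center i) k ((τ (P.center i)).formHom x (η x)))) := by
              change fiberForm F g K x (P.f i x • _) ((P.χ i x * P.f i x) • _) = _
              rw [map_smul, map_smul, LinearMap.smul_apply, smul_smul]
              rfl
            rw [h3, map_smul, (τ (P.center i)).formHom_fiberForm hxi, h1, h1]
          rw [Finset.sum_congr rfl fun k _ => h2 k, ← Finset.smul_sum, haL]
        -- Off the base set the trivialization says nothing, but both sides carry the factor `f_i(x)
        -- = 0`.
        · have h0 : P.f i x = 0 :=
            image_eq_zero_of_notMem_tsupport fun h => hxi (P.tsupport_subset i h)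
          rw [h0, mul_zero, zero_smul]
          refine Finset.sum_eq_zero fun k _ => ?_
          change fiberForm F g K x (P.f i x • _) _ = 0
          rw [h0, zero_smul, map_zero, LinearMap.zero_apply]
      rw [Fintype.sum_prod_type, Finset.sum_congr rfl fun i _ => hi i, ← Finset.sum_smul,
        Finset.sum_coe_sort (P.indices C) (fun i => P.χ i x * P.f i x * P.f i x),
        P.sum_indices hx, one_smul]
    · have hηx : η x = 0 := CompactSection.eq_zero_of_notMem hη hx
      rw [hηx]
      refine Finset.sum_eq_zero fun j _ => ?_
      have h0 : T j (CompactSection.toSmooth E _ _ η) x = 0 := by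
        change (_ : ℝ) • (τ (P.center j.1)).triv.symmₗ ℝ x
          (L (P.center j.1) j.2 ((τ (P.center j.1)).formHom x (η x))) = 0
        rw [hηx, map_zero, map_zero, map_zero, smul_zero]
      rw [sectionForm_apply, h0, map_zero]
  let e := Fintype.equivFin J
  refine ⟨Fintype.card J, φ ∘ e.symm, T ∘ e.symm,
    fun k => CompactSection.continuous_transfer _ _ _ _ _ _, fun η hη => ?_⟩
  refine (e.symm.sum_comp fun j =>
    sectionForm E F g K (φ j) (T j (CompactSection.toSmooth E _ _ η))).trans (hsum η hη)

lemma lift_sectionForm_surjective [T2Space M] [SigmaCompactSpace M] :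
    Function.Surjective (TensorProduct.lift (sectionForm E F g K)) := by
  intro η
  obtain ⟨n, φ, T, -, h⟩ := exists_sum_sectionForm (E := E) (F := F) (g := g) (K := K)
    η.supportCompacts
  refine ⟨∑ k, φ k ⊗ₜ T k (CompactSection.toSmooth E _ _ η), ?_⟩
  rw [map_sum, ← h η subset_rfl]
  simp only [TensorProduct.lift.tmul, h η subset_rfl]

variable [∀ x, IsTopologicalAddGroup (K x)] [∀ x, ContinuousSMul ℝ (K x)]
  {D : CompactSection E F K →ₗ[ℝ] CompactOneForm E F K}

/-- This is the well-definedness of `d`. At each point and tangent vector `β` factors through `κ_K`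
by the linear map `P`, so a relation among values of `κ_K` passes to `β`. -/
lemma ker_lift_sectionForm_le [T2Space M] (hD : IsLieConnection D) :
    LinearMap.ker (TensorProduct.lift (sectionForm E F g K)) ≤
      LinearMap.ker (TensorProduct.lift (connectionForm D)) := by
  intro u hu
  rw [LinearMap.mem_ker] at hu ⊢
  ext x v
  obtain ⟨τ, hτ⟩ := IsLieAlgebraBundle.exists_triv (F := F) (g := g) (K := K) x
  obtain ⟨P, hP⟩ := τ.exists_linearMap_connectionForm hτ v hD
  have h : ∀ u, P (TensorProduct.lift (sectionForm E F g K) u) =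
      τ.formHom x (TensorProduct.lift (connectionForm D) u x v) := by
    intro u
    induction u using TensorProduct.induction_on with
    | zero => simp
    | tmul s t => simpa using hP s t
    | add s t hs ht =>
      rw [map_add, map_add, map_add, hs, ht, CompactSection.add_apply, add_apply, map_add]
  apply τ.formHom_injective hτ
  rw [← h, hu, map_zero]
  exact (map_zero _).symm

lemma continuous_oneFormForm_comp [T2Space M] [SigmaCompactSpace M] (hD : Continuous D) :
    Continuous fun p : CompactSection E F K × CompactSection E F K =>
      oneFormForm E F g K (D p.1) p.2 :=
  LinearMap.continuous₂_comp continuous_oneFormForm hD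

lemma continuous_connectionForm [T2Space M] [SigmaCompactSpace M] (hD : Continuous D)
    (s : CompactSection E F K) : Continuous (connectionForm D s) :=
  LinearMap.continuous_comp_add_flip continuous_oneFormForm hD s

/-- On sections supported in `C`, `d η = ∑ β(φ_k, T_k η)` with fixed `φ_k`; only continuity of `β`
in its second argument is needed. -/
lemma continuous_of_comp_form [T2Space M] [SigmaCompactSpace M] (hD : Continuous D)
    {d : CompactSection E (UniversalFormModel g) (UniversalFormFiber F g K) →ₗ[ℝ]
      CompactOneForm E (UniversalFormModel g) (UniversalFormFiber F g K)}
    (hd : ∀ s t : CompactSection E F K, d (sectionForm E F g K s t) = connectionForm D s t) :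
    Continuous d := by
  refine CompactSection.continuous_of_seminorm_le d fun p hp C => ?_
  obtain ⟨n, φ, T, hT, h⟩ := exists_sum_sectionForm (E := E) (F := F) (g := g) (K := K) C
  refine ⟨∑ k, p.comp (connectionForm D (φ k) ∘ₗ T k), Seminorm.continuous_finsetSum fun k _ =>
    hp.comp ((continuous_connectionForm hD _).comp (hT k)), fun η hη => ?_⟩
  conv_lhs => rw [← h η hη]
  rw [map_sum, Seminorm.finsetSum_apply]
  simp only [hd]
  exact Finset.le_sum_of_subadditive p (map_zero p).le (map_add_le_add p) _ _

/-- It suffices to treat values `κ_K(s, t)`, where `f` can be moved onto `s`. The Koszul rule of `D`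
then contributes the term `df(v) κ(s, t)`. -/
lemma isKoszulConnection_of_comp_form [T2Space M] [SigmaCompactSpace M] (hD : IsKoszulConnection D)
    {d : CompactSection E (UniversalFormModel g) (UniversalFormFiber F g K) →ₗ[ℝ]
      CompactOneForm E (UniversalFormModel g) (UniversalFormFiber F g K)}
    (hd : ∀ s t : CompactSection E F K, d (sectionForm E F g K s t) = connectionForm D s t) :
    IsKoszulConnection d := by
  intro f η x v
  obtain ⟨u, rfl⟩ := lift_sectionForm_surjective η
  induction u using TensorProduct.induction_on with
  | zero =>
    have : f • (0 : CompactSection E (UniversalFormModel g) (UniversalFormFiber F g K)) = 0 :=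
      CompactSection.ext fun x => smul_zero (f x)
    simp [this]
  | tmul s t =>
    have h : f • sectionForm E F g K s t = sectionForm E F g K (f • s) t :=
      CompactSection.ext fun x => by
        rw [CompactSection.fun_smul_apply, sectionForm_apply, sectionForm_apply,
          CompactSection.fun_smul_apply, map_smul, LinearMap.smul_apply]
    rw [TensorProduct.lift.tmul, h, hd, hd, connectionForm_apply, connectionForm_apply, hD,
      sectionForm_apply, CompactSection.fun_smul_apply]
    simp only [map_add, map_smul, LinearMap.add_apply, LinearMap.smul_apply]
    module
  | add s t hs ht =>
    have h : ∀ s t : CompactSection E (UniversalFormModel g) (UniversalFormFiber F g K),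
        f • (s + t) = f • s + f • t := fun s t => CompactSection.ext fun x => smul_add (f x) _ _
    rw [map_add, h, map_add, CompactSection.add_apply, add_apply, hs, ht, map_add,
      CompactSection.add_apply, add_apply, CompactSection.add_apply]
    module

/-- A continuous Lie connection on `K` induces a connection on `V(K)`. -/
theorem exists_isInducedConnection [T2Space M] [SigmaCompactSpace M] (hD : Continuous D)
    (hLie : IsLieConnection D) :
    ∃ d : CompactSection E (UniversalFormModel g) (UniversalFormFiber F g K) →ₗ[ℝ]
      CompactOneForm E (UniversalFormModel g) (UniversalFormFiber F g K),
      IsInducedConnection D d := by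
  -- `r` is an arbitrary linear choice of preimages. It sends `κ_K(s, t)` to `s ⊗ t` only up to the
  -- kernel, on which `β` vanishes.
  obtain ⟨r, hr⟩ := (TensorProduct.lift (sectionForm E F g K)).exists_rightInverse_of_surjective
    (LinearMap.range_eq_top.2 lift_sectionForm_surjective)
  let d := TensorProduct.lift (connectionForm D) ∘ₗ r
  have hd : ∀ s t : CompactSection E F K,
      d (sectionForm E F g K s t) = connectionForm D s t := by
    intro s t
    have h : r (sectionForm E F g K s t) - s ⊗ₜ t ∈
        LinearMap.ker (TensorProduct.lift (sectionForm E F g K)) := by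
      rw [LinearMap.mem_ker, map_sub, TensorProduct.lift.tmul, sub_eq_zero]
      exact LinearMap.congr_fun hr _
    have := ker_lift_sectionForm_le hLie h
    rwa [LinearMap.mem_ker, map_sub, TensorProduct.lift.tmul, sub_eq_zero] at this
  exact ⟨d, continuous_of_comp_form hD hd, isKoszulConnection_of_comp_form hLie.1 hd, hd⟩

/-- The values of `κ_K` span the sections of `V(K)`, so the formula on them determines the
connection. -/
lemma IsInducedConnection.eq [T2Space M] [SigmaCompactSpace M]
    {d d' : CompactSection E (UniversalFormModel g) (UniversalFormFiber F g K) →ₗ[ℝ]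
      CompactOneForm E (UniversalFormModel g) (UniversalFormFiber F g K)}
    (hd : IsInducedConnection D d) (hd' : IsInducedConnection D d') : d' = d := by
  refine LinearMap.ext fun η => ?_
  obtain ⟨u, rfl⟩ := lift_sectionForm_surjective η
  induction u using TensorProduct.induction_on with
  | zero => simp
  | tmul s t => rw [TensorProduct.lift.tmul, hd.comp_form, hd'.comp_form]
  | add s t hs ht => rw [map_add, map_add, map_add, hs, ht]

end InducedConnection

/-! ### The cocycle -/

/-- An alternating bilinear map that satisfies the cocycle identity is a 2-cocycle with values in a
trivial module. -/
lemma exists_twoCocycle_trivial {R L Q : Type*} [CommRing R] [LieRing L] [LieAlgebra R L]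
    [AddCommGroup Q] [Module R Q] (b : L →ₗ[R] L →ₗ[R] Q) (h : ∀ x, b x x = 0)
    (hc : ∀ x y z, b x ⁅y, z⁆ = b ⁅x, y⁆ z + b y ⁅x, z⁆) :
    ∃ c : LieModule.Cohomology.twoCocycle R L (TrivialLieModule R L Q),
      ∀ x y, TrivialLieModule.equiv R L Q (c.1 x y) = b x y := by
  let a : LieModule.Cohomology.twoCochain R L (TrivialLieModule R L Q) :=
    ⟨b.compr₂ ((TrivialLieModule.equiv R L Q).symm : Q →ₗ[R] TrivialLieModule R L Q), fun x =>
      (congrArg (TrivialLieModule.equiv R L Q).symm (h x)).trans (map_zero _)⟩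
  exact ⟨⟨a, (LieModule.Cohomology.mem_twoCocycle_iff_of_trivial R L _ a).2 fun x y z =>
    (congrArg (TrivialLieModule.equiv R L Q).symm (hc x y z)).trans (map_add _ _ _)⟩,
    fun _ _ => rfl⟩

lemma Submodule.continuous_mkQ_comp {R X Q : Type*} [Ring R] [TopologicalSpace X]
    [AddCommGroup Q] [Module R Q] [TopologicalSpace Q] (N : Submodule R Q) {u : X → Q}
    (hu : Continuous u) : Continuous fun x => N.mkQ (u x) :=
  N.continuous_mkQ.comp hu

section Cocycle

variable {E : Type*} [NormedAddCommGroup E] [NormedSpace ℝ E] [FiniteDimensional ℝ E]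
  {M : Type*} [TopologicalSpace M] [ChartedSpace E M] [IsManifold 𝓘(ℝ, E) ∞ M]
  {F : Type*} [NormedAddCommGroup F] [NormedSpace ℝ F]
  {g : Type*} [LieRing g] [LieAlgebra ℝ g] [FiniteDimensional ℝ g]
  {K : M → Type*} [∀ x, LieRing (K x)] [∀ x, LieAlgebra ℝ (K x)]
  [TopologicalSpace (TotalSpace F K)] [∀ x, TopologicalSpace (K x)]
  [FiberBundle F K] [VectorBundle ℝ F K] [ContMDiffVectorBundle ∞ F K 𝓘(ℝ, E)]
  [IsLieAlgebraBundle F g K]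
  [∀ x, IsTopologicalAddGroup (K x)] [∀ x, ContinuousSMul ℝ (K x)]
  {D : CompactSection E F K →ₗ[ℝ] CompactOneForm E F K}
  {d : CompactSection E (UniversalFormModel g) (UniversalFormFiber F g K) →ₗ[ℝ]
    CompactOneForm E (UniversalFormModel g) (UniversalFormFiber F g K)}

/-- Since `β(η, η) = 2 κ̃_K(Dη, η)`, the representing one-form is `d` of `κ_K(η, η) / 2`. -/
lemma connectionCocycle_self (hd : IsInducedConnection D d) (η : CompactSection E F K) :
    connectionCocycle D d η η = 0 := by
  refine (Submodule.Quotient.mk_eq_zero _).2 ⟨(2⁻¹ : ℝ) • sectionForm E F g K η η, ?_⟩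
  have h : connectionForm D η η =
      oneFormForm E F g K (D η) η + oneFormForm E F g K (D η) η := rfl
  rw [map_smul, hd.comp_form, h, ← two_smul ℝ, smul_smul, inv_mul_cancel₀ two_ne_zero, one_smul]
  rfl

/-- The cocycle identity before passing to the quotient. Expanding `D[s, t]`, invariance turns
`κ([Ds, t], u)` into `κ(Ds, [t, u])`, while `κ([s, Dt], u) = -κ(Dt, [s, u])` cancels the last term.
-/
lemma oneFormForm_lie (hD : IsLieConnection D) (s t u : CompactSection E F K) :
    oneFormForm E F g K (D s) ⁅t, u⁆ =
      oneFormForm E F g K (D ⁅s, t⁆) u + oneFormForm E F g K (D t) ⁅s, u⁆ := by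
  ext x v
  rw [CompactSection.add_apply, add_apply, oneFormForm_apply, oneFormForm_apply,
    oneFormForm_apply, hD.2, CompactSection.lie_apply, CompactSection.lie_apply]
  have h : ∀ a b c : K x, fiberForm F g K x ⁅a, b⁆ c = fiberForm F g K x a ⁅b, c⁆ :=
    universalForm_invariant
  rw [map_add, LinearMap.add_apply, ← lie_skew (s x), map_neg, LinearMap.neg_apply, h, h,
    neg_add_cancel_right]

lemma connectionCocycle_lie (hD : IsLieConnection D) (s t u : CompactSection E F K) :
    connectionCocycle D d s ⁅t, u⁆ =
      connectionCocycle D d ⁅s, t⁆ u + connectionCocycle D d t ⁅s, u⁆ :=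
  (congrArg (LinearMap.range d).mkQ (oneFormForm_lie hD s t u)).trans (map_add _ _ _)

lemma continuous_connectionCocycle [T2Space M] [SigmaCompactSpace M] (hD : Continuous D) :
    Continuous fun p : CompactSection E F K × CompactSection E F K =>
      connectionCocycle D d p.1 p.2 :=
  (LinearMap.range d).continuous_mkQ_comp (continuous_oneFormForm_comp hD)

end Cocycle

end

theorem mainTheorem6
    {E : Type*} [NormedAddCommGroup E] [NormedSpace ℝ E] [FiniteDimensional ℝ E]
    {M : Type*} [TopologicalSpace M] [ChartedSpace E M] [IsManifold 𝓘(ℝ, E) ∞ M]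
    [T2Space M] [SigmaCompactSpace M]
    {F : Type*} [NormedAddCommGroup F] [NormedSpace ℝ F]
    {g : Type*} [LieRing g] [LieAlgebra ℝ g] [FiniteDimensional ℝ g]
    (hperfect : ⁅(⊤ : LieIdeal ℝ g), (⊤ : LieIdeal ℝ g)⁆ = ⊤)
    {K : M → Type*} [∀ x, LieRing (K x)] [∀ x, LieAlgebra ℝ (K x)]
    [TopologicalSpace (TotalSpace F K)] [∀ x, TopologicalSpace (K x)]
    [∀ x, IsTopologicalAddGroup (K x)] [∀ x, ContinuousSMul ℝ (K x)]
    [FiberBundle F K] [VectorBundle ℝ F K] [ContMDiffVectorBundle ∞ F K 𝓘(ℝ, E)]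
    [IsLieAlgebraBundle F g K]
    (D : CompactSection E F K →ₗ[ℝ] CompactOneForm E F K)
    (hD : Continuous D) (hLie : IsLieConnection D) :
    ∃ d : CompactSection E (UniversalFormModel g) (UniversalFormFiber F g K) →ₗ[ℝ]
        CompactOneForm E (UniversalFormModel g) (UniversalFormFiber F g K),
      IsInducedConnection D d ∧ (∀ d', IsInducedConnection D d' → d' = d) ∧
      (∃ c : LieModule.Cohomology.twoCocycle ℝ (CompactSection E F K)
          (TrivialLieModule ℝ (CompactSection E F K)
            (CompactOneForm E (UniversalFormModel g) (UniversalFormFiber F g K) ⧸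
              LinearMap.range d)),
        ∀ η ζ : CompactSection E F K,
          TrivialLieModule.equiv ℝ (CompactSection E F K) _ (c.1 η ζ) =
            connectionCocycle D d η ζ) ∧
      Continuous fun p : CompactSection E F K × CompactSection E F K =>
        connectionCocycle D d p.1 p.2 := by
  refine (exists_isInducedConnection hD hLie).elim fun d hd => Exists.intro d ?_
  refine And.intro hd (And.intro (fun d' hd' => hd.eq hd') (And.intro ?_ ?_))
  · exact exists_twoCocycle_trivial (connectionCocycle D d) (connectionCocycle_self hd)
      (connectionCocycle_lie hLie)
  · exact continuous_connectionCocycle hD
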